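/- **Linear BTK algorithm.** For nonnegative integers $k_1,\dots,k_n$ let $M(n,k_1,\dots,k_n)=\{x\in\mathbb N^n : x_i\le k_i\}$, ordered componentwise, with rank $x_1+\cdots+x_n$, and let $V(P)$ be the complex vector space with basis $P$. The algorithm produces a set of chains (finite sequences) of integral vectors of $V(M(n,k_1,\dots,k_n))$. *Pairs.* For $M(2,p,q)$ with $p=0$ or $q=0$ it produces the single chain of all points of the poset. For $p,q\ge1$ it produces the chain $(v(0),\dots,v(p+q))$ with $v(l)=\sum_{i+j=l,\ 0\le i\le p,\ 0\le j\le q}\binom{l}{i}(i,j)$, together with the images of the chains produced for $M(2,p-1,q-1)$ under the linear map $(i,j)\mapsto v(i,j+1)$, where $v(i,j)=(p-i)(i,j)-(q-j+1)(i+1,j-1)$ for $0\le i\le p-1$, $1\le j\le q$. *General case.* For $n=0$ it produces the one-vector chain consisting of the only point. For $M(n+1,k_1,\dots,k_{n+1})$, take each chain $(x_0,\dots,x_l)$ produced for $M(n,k_1,\dots,k_n)$, write $R_j$ for the linear map $(a_1,\dots,a_n)\mapsto(a_1,\dots,a_n,j)$, and take the images of the chains produced for $M(2,l,k_{n+1})$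 under the linear map $(i,j)\mapsto R_j(x_i)$. The output consists of all the chains so obtained. Let $B(n)=M(n,1,\dots,1)$, identified with the set of subsets of $\{1,\dots,n\}$, and let $O(n)$ be the set of all vectors in the chains produced for $B(n)$. **Notation.** Let $n\ge0$ be an integer, $m=\lfloor n/2\rfloor$, and for $0\le k\le m$ put $p_k=n-2k+1$ and $q_k=\binom nk-\binom n{k-1}$ (with $\binom n{-1}=0$). The Terwilliger algebra $\mathcal A_n$ of the binary Hamming scheme is the $*$-algebra of complex $B(n)\times B(n)$ matrices $M$ with $M(\pi(X),\pi(Y))=M(X,Y)$ for all $X,Y\in B(n)$ and $\pi\in S_n$. For nonnegative integers $i,j,t$, $M^t_{i,j}\in\mathcal A_n$ is the matrix with entry $1$ at $(X,Y)$ if $|X|=i$, $|Y|=j$, $|X\cap Y|=t$, and $0$ otherwise. Let $$\beta^t_{i,j,k}=\sum_{u=0}^n(-1)^{u-t}\binom ut\binom{n-2k}{u-k}\binom{n-k-u}{i-u}\binom{n-k-u}{j-u},$$ where $\binom ab=0$ for $b<0$. For $k\le i,j\le n-k$ let $E_{i,j,k}$ be the $p_k\times p_k$ matrix, with rows and columns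 indexed by $k,k+1,\dots,n-k$, whose $(i,j)$ entry is $1$ and whose other entries are $0$. **Theorem.** For every $0\le k\le m$ there are exactly $q_k$ chains in $O(n)$ starting at rank $k$ and ending at rank $n-k$. Fix any ordering of these chains, for every $k$. Then the vectors of $O(n)$ are indexed bijectively by the set $S$ of triples $(k,b,i)$ with $0\le k\le m$, $1\le b\le q_k$, $k\le i\le n-k$: the vector with index $(k,b,i)$ is the one of rank $i$ on the $b$-th chain from rank $k$ to rank $n-k$. Let $N(n)$ be the real $B(n)\times S$ matrix whose columns are the vectors of $O(n)$, each divided by its Euclidean length. Then: 1. $N(n)$ is unitary, and $N(n)^*\mathcal A_nN(n)$ is exactly the set of block diagonal $S\times S$ matrices in which, for each $0\le k\le m$, one and the same $p_k\times p_k$ block $B_k$, an arbitrary complex matrix with rows and columns indexed by $k,\dots,n-k$, is repeated $q_k$ times (once for each $b$). 2. The map $\Phi$ given by conjugation $M\mapsto N(n)^*MN(n)$ followed by dropping the repeated blocks is an isomorphism of $*$-algebras $\Phi:\mathcal A_n\to\bigoplus_{k=0}^{m}\mathrm{Mat}(p_k\times p_k)$. 3. Let $i,j,t\in\{0,\dots,n\}$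 and write $\Phi(M^t_{i,j})=(N_0,\dots,N_m)$. Then, for $0\le k\le m$, $$N_k=\begin{cases}\binom{n-2k}{i-k}^{-1/2}\binom{n-2k}{j-k}^{-1/2}\,\beta^t_{i,j,k}\,E_{i,j,k}&\text{if }k\le i,j\le n-k,\\0&\text{otherwise.}\end{cases}$$ -/

import Mathlib

/-! ## The linear BTK algorithm on a product of chains

A vector of `V(M(2,p,q))` is given by its integer coordinates `w i j` at the points `(i, j)`,
a vector of `V(M(n,k₁,…,kₙ))` by its integer coordinates at the points `a : Fin n → ℕ`;
coordinates outside the poset are zero.  A symmetric Jordan basis is given as the list of its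
Jordan chains, and each chain as the list of its vectors, by increasing rank. -/

/-- The basis vector `(a, b)`. -/
def pairUnit (a b : ℕ) : ℕ → ℕ → ℤ := fun i j => if i = a ∧ j = b then 1 else 0

/-- The vector `v(k) = U^k((0,0)) = ∑_{i+j=k} (k choose i) (i, j)` of `V(M(2,p,q))`. -/
def pairMain (p q k : ℕ) : ℕ → ℕ → ℤ :=
  fun i j => if i ≤ p ∧ j ≤ q ∧ i + j = k then (k.choose i : ℤ) else 0

/-- The vector `v(i,j) = (p-i) (i, j) - (q-j+1) (i+1, j-1)`, for `0 ≤ i ≤ p-1`, `1 ≤ j ≤ q`. -/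
def pairVec (p q i j : ℕ) : ℕ → ℕ → ℤ :=
  ((p : ℤ) - i) • pairUnit i j - ((q : ℤ) - j + 1) • pairUnit (i + 1) (j - 1)

/-- The linear map `V(M(2,p,q)) → V(M(2,p+1,q+1))` with `(i, j) ↦ v(i, j+1)`. -/
def pairTransfer (p q : ℕ) (w : ℕ → ℕ → ℤ) : ℕ → ℕ → ℤ :=
  ∑ i ∈ Finset.range (p + 1), ∑ j ∈ Finset.range (q + 1), w i j • pairVec (p + 1) (q + 1) i (j + 1)

/-- The symmetric Jordan chains of `V(M(2,p,q))` that the algorithm produces. -/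
def pairBTK : ℕ → ℕ → List (List (ℕ → ℕ → ℤ))
  | 0, q => [(List.range (q + 1)).map fun j => pairUnit 0 j]
  | p + 1, 0 => [(List.range (p + 2)).map fun i => pairUnit i 0]
  | p + 1, q + 1 =>
      (List.range (p + q + 3)).map (pairMain (p + 1) (q + 1)) ::
        (pairBTK p q).map (List.map (pairTransfer p q))

/-- The copy in the layer `aₙ₊₁ = j` of a vector of `V(M(n,k₁,…,kₙ))`. -/
def layerCopy {n : ℕ} (j : ℕ) (v : (Fin n → ℕ) → ℤ) : (Fin (n + 1) → ℕ) → ℤ :=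
  fun a => if a (Fin.last n) = j then v (fun i => a i.castSucc) else 0

/-- For a chain `x = (x₀,…,x_l)`, the linear map that sends the point `(i, j)` of `M(2,l,q)` to the
copy of `x_i` in the layer `j`. -/
def chainMap {n : ℕ} (q : ℕ) (x : List ((Fin n → ℕ) → ℤ)) (w : ℕ → ℕ → ℤ) :
    (Fin (n + 1) → ℕ) → ℤ :=
  ∑ i ∈ Finset.range x.length, ∑ j ∈ Finset.range (q + 1), w i j • layerCopy j (x.getD i 0)

/-- The linear BTK algorithm: the symmetric Jordan chains it produces for `V(M(n,k₁,…,kₙ))`.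
Every chain `(x₀,…,x_l)` of the basis for the first coordinates spans, with its copies in the
layers, a space that looks like `V(M(2,l,kₙ₊₁))`, whose chains are carried over. -/
def linearBTK : (n : ℕ) → (Fin n → ℕ) → List (List ((Fin n → ℕ) → ℤ))
  | 0, _ => [[fun _ => 1]]
  | n + 1, k =>
      (linearBTK n fun i => k i.castSucc).flatMap fun x =>
        (pairBTK (x.length - 1) (k (Fin.last n))).map (List.map (chainMap (k (Fin.last n)) x))

/-! ## The Boolean algebra -/

/-- The chains of `O(n)`: the output of the linear BTK algorithm on `B(n) = M(n,1,…,1)`, with the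
points of `B(n)` regarded as subsets of an `n`-element set. -/
def boolChains (n : ℕ) : List (List (Finset (Fin n) → ℤ)) :=
  (linearBTK n fun _ => 1).map (List.map fun v X => v fun i => if i ∈ X then 1 else 0)

/-- `v` is a nonzero homogeneous vector of `V(B(n))`, of rank `r`. -/
def HasRank {n : ℕ} (v : Finset (Fin n) → ℤ) (r : ℕ) : Prop :=
  v ≠ 0 ∧ ∀ X, v X ≠ 0 → X.card = r

instance {n : ℕ} (v : Finset (Fin n) → ℤ) (r : ℕ) : Decidable (HasRank v r) :=
  inferInstanceAs (Decidable (v ≠ 0 ∧ ∀ X, v X ≠ 0 → X.card = r))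

/-- The chains of `O(n)` that start at rank `k` and end at rank `n - k`. -/
def chainsFrom (n k : ℕ) : List (List (Finset (Fin n) → ℤ)) :=
  (boolChains n).filter fun c => HasRank (c.headD 0) k ∧ HasRank (c.getLastD 0) (n - k)

/-- `q_k = (n choose k) - (n choose k-1)`, where `(n choose -1) = 0`. -/
def chainCount (n k : ℕ) : ℕ := n.choose k - if k = 0 then 0 else n.choose (k - 1)

theorem chainCount_pos {n k : ℕ} (hk : k ≤ n / 2) : 0 < chainCount n k := by
  unfold chainCount
  rcases k with _ | k
  · simp
  · have h1 := Nat.choose_succ_right_eq n k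
    have h2 : 0 < n.choose k := Nat.choose_pos (by omega)
    have h3 : n.choose k < n.choose (k + 1) := by
      by_contra h
      have h4 : n.choose (k + 1) * (k + 1) ≤ n.choose k * (k + 1) :=
        Nat.mul_le_mul_right _ (not_lt.mp h)
      have h5 : n.choose k * (k + 1) < n.choose k * (n - k) :=
        Nat.mul_lt_mul_of_pos_left (by omega) h2
      omega
    simp only [Nat.add_eq_zero_iff, one_ne_zero, and_false, if_false, Nat.add_sub_cancel]
    omega

/-- The rows and columns `k, k+1, …, n-k` of the `k`-th block. -/
abbrev BlockIdx (n k : ℕ) : Type := ↥(Finset.Icc k (n - k))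

theorem card_blockIdx {n k : ℕ} (hk : k ≤ n / 2) :
    Fintype.card (BlockIdx n k) = n - 2 * k + 1 := by
  simp only [BlockIdx, Fintype.card_coe, Nat.card_Icc]
  omega

/-- The index set `S` of all `(k, b, i)` with `0 ≤ k ≤ ⌊n/2⌋`, `b` one of `q_k` values,
and `k ≤ i ≤ n-k`. -/
abbrev ChainIdx (n : ℕ) : Type :=
  Σ k : Fin (n / 2 + 1), Fin (chainCount n k) × BlockIdx n k

/-- For every `k ≤ ⌊n/2⌋` an ordering of the chains of `O(n)` from rank `k` to rank `n-k`. -/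
abbrev ChainOrder (n : ℕ) : Type :=
  ∀ k : Fin (n / 2 + 1), Fin (chainCount n k) ≃ Fin (chainsFrom n k).length

/-- The vector of `O(n)` with index `(k, b, i)`: the one of rank `i` on the `b`-th chain
`(x_k,…,x_{n-k})` from rank `k` to rank `n-k`. -/
def basisVec {n : ℕ} (σ : ChainOrder n) (s : ChainIdx n) : Finset (Fin n) → ℤ :=
  ((chainsFrom n s.1).get (σ s.1 s.2.1)).getD (s.2.2.1 - s.1) 0

/-- The real matrix `N(n)`: its columns are the normalized vectors of `O(n)`. -/
noncomputable def matN {n : ℕ} (σ : ChainOrder n) : Matrix (Finset (Fin n)) (ChainIdx n) ℝ :=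
  Matrix.of fun X s =>
    (basisVec σ s X : ℝ) / Real.sqrt (∑ Y : Finset (Fin n), (basisVec σ s Y : ℝ) ^ 2)

/-- `N(n)` as a complex matrix. -/
noncomputable def matNC {n : ℕ} (σ : ChainOrder n) : Matrix (Finset (Fin n)) (ChainIdx n) ℂ :=
  (matN σ).map Complex.ofReal

/-! ## The Terwilliger algebra and its block diagonalization -/

/-- The Terwilliger algebra `A_n` of the binary Hamming scheme: the complex `B(n) × B(n)` matrices
with `M(π(X), π(Y)) = M(X, Y)` for all permutations `π`. -/
def terwilliger (n : ℕ) :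
    StarSubalgebra ℂ (Matrix (Finset (Fin n)) (Finset (Fin n)) ℂ) where
  carrier := {M | ∀ (π : Equiv.Perm (Fin n)) (X Y : Finset (Fin n)),
    M (X.map π.toEmbedding) (Y.map π.toEmbedding) = M X Y}
  mul_mem' := by
    intro A B hA hB π X Y
    rw [Matrix.mul_apply, Matrix.mul_apply, ← (Equiv.finsetCongr π).sum_comp]
    refine Finset.sum_congr rfl fun Z _ => ?_
    simp only [Equiv.finsetCongr_apply]
    rw [hA, hB]
  add_mem' := by
    intro A B hA hB π X Y
    rw [Matrix.add_apply, Matrix.add_apply, hA, hB]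
  algebraMap_mem' := by
    intro r π X Y
    simp [Matrix.algebraMap_matrix_apply]
  star_mem' := by
    intro A hA π X Y
    rw [Matrix.star_apply, Matrix.star_apply, hA]

/-- The matrix `M^t_{i,j}`. -/
def matM (n i j t : ℕ) : Matrix (Finset (Fin n)) (Finset (Fin n)) ℂ :=
  Matrix.of fun X Y => if X.card = i ∧ Y.card = j ∧ (X ∩ Y).card = t then 1 else 0

theorem matM_mem (n i j t : ℕ) : matM n i j t ∈ terwilliger n := by
  intro π X Y
  simp [matM, ← Finset.map_inter]

/-- The algebra `⊕_{k=0}^{⌊n/2⌋} Mat(p_k × p_k)`, `p_k = n - 2k + 1`. -/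
abbrev BlockAlg (n : ℕ) : Type :=
  ∀ k : Fin (n / 2 + 1), Matrix (BlockIdx n k) (BlockIdx n k) ℂ

open scoped Kronecker in
/-- The block diagonal matrix in which the `k`-th block is repeated `q_k` times. -/
def repeatBlocks {n : ℕ} (B : BlockAlg n) : Matrix (ChainIdx n) (ChainIdx n) ℂ :=
  Matrix.blockDiagonal' fun k => (1 : Matrix (Fin (chainCount n k)) (Fin (chainCount n k)) ℂ) ⊗ₖ B k

/-- Conjugation by `N(n)`. -/
noncomputable def conjN {n : ℕ} (σ : ChainOrder n)
    (M : Matrix (Finset (Fin n)) (Finset (Fin n)) ℂ) : Matrix (ChainIdx n) (ChainIdx n) ℂ :=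
  (matNC σ).conjTranspose * M * matNC σ

/-- Dropping repeated blocks: of the `q_k` diagonal blocks with first index `k`, keep one. -/
def dropBlocks {n : ℕ} (D : Matrix (ChainIdx n) (ChainIdx n) ℂ) : BlockAlg n := fun k =>
  Matrix.of fun i j =>
    D ⟨k, ⟨0, chainCount_pos (Nat.lt_succ_iff.mp k.2)⟩, i⟩
      ⟨k, ⟨0, chainCount_pos (Nat.lt_succ_iff.mp k.2)⟩, j⟩

/-- The map `Φ`: conjugation by `N(n)` followed by dropping repeated blocks. -/
noncomputable def Phi {n : ℕ} (σ : ChainOrder n)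
    (M : Matrix (Finset (Fin n)) (Finset (Fin n)) ℂ) : BlockAlg n :=
  dropBlocks (conjN σ M)

/-- The binomial coefficient of two integers, which is `0` if the lower one is negative. -/
def binom (a b : ℤ) : ℤ := if 0 ≤ b then Ring.choose a b.toNat else 0

/-- The number `β^t_{i,j,k}`; the terms with `u < t` vanish, so `(-1)^{u+t} = (-1)^{u-t}`. -/
def beta (n i j k t : ℕ) : ℤ :=
  ∑ u ∈ Finset.range (n + 1), (-1) ^ (u + t) * binom u t * binom (n - 2 * k) (u - k) *
    binom (n - k - u) (i - u) * binom (n - k - u) (j - u)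

/-! Divided by factorials, a chain of `O(n)` starting at rank k becomes `e 0, …, e l`, `l = n - 2 *
k`, a standard basis of an irreducible sl₂-module: the down operator D, which sums over covers,
sends `e a` to (l - a + 1) `e (a - 1)`. As D^c / c! sums over the supersets with c more points, the
superset sum of `e a` is ∑_b C(l - b, a - b) `e b`; moreover |`e a`|² = C(l, a) |`e 0`|². These two
facts, recorded in `IsSymmChain`, replace the Jordan structure in all that follows.

They are inherited from B(n) by B(n + 1): the span of two copies of a chain with l + 1 vectors
splits into `mainChain`, with l + 2 vectors, and `sideChain`, with l. These are the chains that a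
BTK step produces (`boolChains_eq`). All chains are mutually orthogonal (`chainData_pairwise`) and
contain 2^n vectors altogether, so `N(n)` is unitary.

On fixed ranks, a matrix with entries ∑_{Z ⊆ X ∩ Y} f(|Z|) is an inclusion matrix times a diagonal
matrix times a transposed inclusion matrix. Superset sums stay within a chain, with coefficients
depending only on k, so `N(n)` brings such a matrix to repeated blocks
(`IsChainBasis.conjN_subsetSumMatrix`). Binomial inversion gives M^t_{i,j} this form
(`matM_eq_subsetSumMatrix`), whence β; and the M^t_{i,j} span the Terwilliger algebra
(`eq_sum_matM`). Conversely, when f is the indicator of k, the blocks beyond k vanish and the k-th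
is a nonzero multiple of a matrix unit. A triangular induction then yields every matrix unit
(`IsChainBasis.repeatBlocks_single_mem`). -/

open Finset

/-! ### Splitting B(n + 1) into two copies of B(n); superset sums -/

/-- The function on subsets of `Fin (n + 1)` that is `v` on those without the last point and `w` on
those with it. -/
def glue {n : ℕ} (v w : Finset (Fin n) → ℤ) : Finset (Fin (n + 1)) → ℤ := fun X =>
  if Fin.last n ∈ X then w (univ.filter fun i => i.castSucc ∈ X)
  else v (univ.filter fun i => i.castSucc ∈ X)

theorem glue_map_castSucc {n : ℕ} (v w : Finset (Fin n) → ℤ) (Y : Finset (Fin n)) :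
    glue v w (Y.map Fin.castSuccEmb) = v Y := by
  have h : (univ.filter fun i : Fin n => i.castSucc ∈ Y.map Fin.castSuccEmb) = Y := by
    ext i; simp
  unfold glue
  rw [h, if_neg]
  simp [Fin.castSucc_ne_last]

theorem glue_insert_last {n : ℕ} (v w : Finset (Fin n) → ℤ) (Y : Finset (Fin n)) :
    glue v w (insert (Fin.last n) (Y.map Fin.castSuccEmb)) = w Y := by
  have h : (univ.filter fun i : Fin n =>
      i.castSucc ∈ insert (Fin.last n) (Y.map Fin.castSuccEmb)) = Y := by
    ext i; simp [Fin.castSucc_ne_last]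
  unfold glue
  rw [h, if_pos (mem_insert_self _ _)]

theorem eq_map_castSucc_or {n : ℕ} (X : Finset (Fin (n + 1))) :
    (∃ Y : Finset (Fin n), X = Y.map Fin.castSuccEmb) ∨
      ∃ Y : Finset (Fin n), X = insert (Fin.last n) (Y.map Fin.castSuccEmb) := by
  by_cases h : Fin.last n ∈ X
  · refine Or.inr ⟨univ.filter fun i => i.castSucc ∈ X, ?_⟩
    ext i
    refine Fin.lastCases ?_ (fun j => ?_) i
    · simp [h]
    · simp [Fin.castSucc_ne_last]
  · refine Or.inl ⟨univ.filter fun i => i.castSucc ∈ X, ?_⟩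
    ext i
    refine Fin.lastCases ?_ (fun j => ?_) i
    · simp [h, Fin.castSucc_ne_last]
    · simp

theorem sum_finset_fin_succ {n : ℕ} (F : Finset (Fin (n + 1)) → ℤ) :
    ∑ X, F X = ∑ Y : Finset (Fin n), F (Y.map Fin.castSuccEmb) +
      ∑ Y : Finset (Fin n), F (insert (Fin.last n) (Y.map Fin.castSuccEmb)) := by
  have hl : Fin.last n ∉ (univ : Finset (Fin n)).map Fin.castSuccEmb := by
    simp [Fin.castSucc_ne_last]
  have hu : (univ : Finset (Fin (n + 1))) = insert (Fin.last n) (univ.map Fin.castSuccEmb) := by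
    ext i
    refine Fin.lastCases ?_ (fun j => ?_) i <;> simp
  have hp : ∀ G : Finset (Fin (n + 1)) → ℤ,
      ∑ X ∈ ((univ : Finset (Fin n)).map Fin.castSuccEmb).powerset, G X =
        ∑ Y : Finset (Fin n), G (Y.map Fin.castSuccEmb) := by
    intro G
    symm
    refine sum_bij (fun Y _ => Y.map Fin.castSuccEmb) ?_ ?_ ?_ ?_
    · intro Y _
      exact mem_powerset.2 (map_subset_map.2 (subset_univ _))
    · intro Y _ Y' _ h
      exact map_injective _ h
    · intro X hX
      rcases eq_map_castSucc_or X with ⟨Y, rfl⟩ | ⟨Y, rfl⟩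
      · exact ⟨Y, mem_univ _, rfl⟩
      · exact absurd (mem_powerset.1 hX (mem_insert_self _ _)) hl
    · intro Y _; rfl
  rw [← powerset_univ, hu, sum_powerset_insert hl, hp, hp]

theorem glue_dotProduct_glue {n : ℕ} (v w v' w' : Finset (Fin n) → ℤ) :
    glue v w ⬝ᵥ glue v' w' = v ⬝ᵥ v' + w ⬝ᵥ w' := by
  simp only [dotProduct, sum_finset_fin_succ, glue_map_castSucc, glue_insert_last]

/-- The sum of `v` over the supersets. -/
def upSum {n : ℕ} (v : Finset (Fin n) → ℤ) : Finset (Fin n) → ℤ := fun Z =>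
  ∑ Y, if Z ⊆ Y then v Y else 0

theorem upSum_smul {n : ℕ} (a : ℤ) (v : Finset (Fin n) → ℤ) : upSum (a • v) = a • upSum v := by
  funext Z
  simp only [upSum, Pi.smul_apply, smul_eq_mul, mul_sum]
  refine sum_congr rfl fun Y _ => ?_
  split_ifs <;> simp

/-- A set without the last point has supersets in both halves, a set with it only in the upper half.
-/
theorem upSum_glue {n : ℕ} (v w : Finset (Fin n) → ℤ) :
    upSum (glue v w) = glue (upSum v + upSum w) (upSum w) := by
  funext Z
  have hs : ∀ Y Y' : Finset (Fin n), Y.map Fin.castSuccEmb ⊆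
      insert (Fin.last n) (Y'.map Fin.castSuccEmb) ↔ Y ⊆ Y' := by
    intro Y Y'
    rw [subset_insert_iff_of_notMem (by simp [Fin.castSucc_ne_last]), map_subset_map]
  have hs' : ∀ Y Y' : Finset (Fin n), insert (Fin.last n) (Y.map Fin.castSuccEmb) ⊆
      insert (Fin.last n) (Y'.map Fin.castSuccEmb) ↔ Y ⊆ Y' := by
    intro Y Y'
    rw [insert_subset_insert_iff (by simp [Fin.castSucc_ne_last]), map_subset_map]
  have hs'' : ∀ Y Y' : Finset (Fin n), ¬ insert (Fin.last n) (Y.map Fin.castSuccEmb) ⊆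
      Y'.map Fin.castSuccEmb := by
    intro Y Y' h
    have := h (mem_insert_self _ _)
    simp [Fin.castSucc_ne_last] at this
  rcases eq_map_castSucc_or Z with ⟨Y, rfl⟩ | ⟨Y, rfl⟩
  · rw [glue_map_castSucc, upSum, sum_finset_fin_succ]
    simp only [glue_map_castSucc, glue_insert_last, hs, map_subset_map, Pi.add_apply, upSum]
  · rw [glue_insert_last, upSum, sum_finset_fin_succ]
    simp only [glue_insert_last, hs', hs'', if_false, sum_const_zero, zero_add, upSum]

theorem glue_zero {n : ℕ} : glue (0 : Finset (Fin n) → ℤ) 0 = 0 := by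
  funext X; simp [glue]

theorem glue_add {n : ℕ} (v w v' w' : Finset (Fin n) → ℤ) :
    glue v w + glue v' w' = glue (v + v') (w + w') := by
  funext X; simp only [glue, Pi.add_apply]; split_ifs <;> rfl

theorem smul_glue {n : ℕ} (a : ℤ) (v w : Finset (Fin n) → ℤ) :
    a • glue v w = glue (a • v) (a • w) := by
  funext X; simp only [glue, Pi.smul_apply]; split_ifs <;> rfl

theorem sum_glue {n : ℕ} {ι : Type*} (s : Finset ι) (v w : ι → Finset (Fin n) → ℤ) :
    ∑ a ∈ s, glue (v a) (w a) = glue (∑ a ∈ s, v a) (∑ a ∈ s, w a) := by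
  classical
  induction s using Finset.induction_on with
  | empty => simp [glue_zero]
  | insert a s ha ih => rw [sum_insert ha, sum_insert ha, sum_insert ha, ih, glue_add]

/-! ### Symmetric chains and their passage from B(n) to B(n + 1) -/

theorem int_choose_succ (c d : ℕ) :
    ((d : ℤ) + 1) * (c.choose (d + 1) : ℤ) = ((c : ℤ) - d) * c.choose d := by
  have := Nat.choose_succ_right_eq c d
  rcases le_or_gt d c with hdc | hdc
  · zify [hdc] at this
    linarith
  · rw [Nat.choose_eq_zero_of_lt hdc, Nat.choose_eq_zero_of_lt (by omega)]
    simp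

theorem int_choose_succ_left (c d : ℕ) :
    ((c : ℤ) + 1 - d) * ((c + 1).choose d : ℤ) = ((c : ℤ) + 1) * (c.choose d : ℤ) := by
  have := Nat.choose_mul_succ_eq c d
  rcases le_or_gt d (c + 1) with hdc | hdc
  · zify [hdc] at this
    linarith
  · rw [Nat.choose_eq_zero_of_lt hdc, Nat.choose_eq_zero_of_lt (by omega)]
    simp

/-- The vectors `a! • e a` for `a ≤ n - 2k` form a symmetric Jordan chain of `V(B(n))` that starts
at rank `k`; expressed through the inclusion matrices. -/
structure IsSymmChain (n k : ℕ) (e : ℕ → Finset (Fin n) → ℤ) : Prop where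
  le : 2 * k ≤ n
  eq_zero : ∀ a, n - 2 * k < a → e a = 0
  card : ∀ a X, e a X ≠ 0 → X.card = k + a
  upSum_eq : ∀ a, upSum (e a) =
    ∑ b ∈ range (a + 1), ((n - 2 * k - b).choose (a - b) : ℤ) • e b
  dot_self : ∀ a, e a ⬝ᵥ e a = ((n - 2 * k).choose a : ℤ) * (e 0 ⬝ᵥ e 0)
  ne_zero : e 0 ⬝ᵥ e 0 ≠ 0

/-- The chain from `(e 0, ∅)` to `(e l, {n + 1})`. -/
def mainChain {n : ℕ} (e : ℕ → Finset (Fin n) → ℤ) : ℕ → Finset (Fin (n + 1)) → ℤ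
  | 0 => glue (e 0) 0
  | a + 1 => glue (e (a + 1)) (e a)

/-- The chain complementary to `mainChain e` in the span of the two copies of `e`. -/
def sideChain {n : ℕ} (l : ℕ) (e : ℕ → Finset (Fin n) → ℤ) (a : ℕ) : Finset (Fin (n + 1)) → ℤ :=
  glue (-((a : ℤ) + 1) • e (a + 1)) (((l : ℤ) - a) • e a)

theorem glue_card {n r : ℕ} {v w : Finset (Fin n) → ℤ} (hv : ∀ X, v X ≠ 0 → X.card = r)
    (hw : ∀ X, w X ≠ 0 → X.card + 1 = r) (X : Finset (Fin (n + 1))) (hX : glue v w X ≠ 0) :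
    X.card = r := by
  rcases eq_map_castSucc_or X with ⟨Y, rfl⟩ | ⟨Y, rfl⟩
  · rw [glue_map_castSucc] at hX
    simpa using hv _ hX
  · rw [glue_insert_last] at hX
    rw [card_insert_of_notMem (by simp [Fin.castSucc_ne_last]), card_map]
    exact hw _ hX

theorem dotProduct_eq_zero_of_card {n r s : ℕ} {v w : Finset (Fin n) → ℤ}
    (hv : ∀ X, v X ≠ 0 → X.card = r) (hw : ∀ X, w X ≠ 0 → X.card = s) (h : r ≠ s) :
    v ⬝ᵥ w = 0 := by
  refine sum_eq_zero fun X _ => ?_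
  by_contra hX
  exact h ((hv X (left_ne_zero_of_mul hX)).symm.trans (hw X (right_ne_zero_of_mul hX)))

/-- Pascal's rule does the work twice: for the superset sums, where the lower half receives
contributions from both copies, and for the squared lengths. -/
theorem IsSymmChain.mainChain {n k : ℕ} {e : ℕ → Finset (Fin n) → ℤ} (h : IsSymmChain n k e) :
    IsSymmChain (n + 1) k (mainChain e) := by
  have hl : n + 1 - 2 * k = n - 2 * k + 1 := by have := h.le; omega
  have hz := h.eq_zero
  have hu := h.upSum_eq
  have hd := h.dot_self
  have h0 : _root_.mainChain e 0 ⬝ᵥ _root_.mainChain e 0 = e 0 ⬝ᵥ e 0 := by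
    simp [_root_.mainChain, glue_dotProduct_glue]
  generalize hn : n - 2 * k = l at *
  refine ⟨by have := h.le; omega, ?_, ?_, ?_, ?_, ?_⟩
  · intro a ha
    rw [hl] at ha
    obtain ⟨a, rfl⟩ : ∃ b, a = b + 1 := ⟨a - 1, by omega⟩
    rw [_root_.mainChain, hz _ (by omega), hz _ (by omega), glue_zero]
  · rintro (_ | a) X hX
    · exact glue_card (h.card 0) (by simp) X hX
    · exact glue_card (h.card (a + 1)) (fun X hX => by rw [h.card a X hX]; ring) X hX
  · rw [hl]
    rintro (_ | a)
    · have := hu 0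
      simp at this
      simp [_root_.mainChain, upSum_glue, this]
      have : upSum (0 : Finset (Fin n) → ℤ) = 0 := by
        funext Z; simp [upSum]
      simp [this]
    · rw [sum_range_succ' _ (a + 1)]
      simp only [_root_.mainChain, upSum_glue, smul_glue, sum_glue, glue_add,
        Nat.add_sub_add_right, smul_zero, add_zero, hu]
      congr 1
      have hr := sum_range_succ' (fun b => ((l + 1 - b).choose (a + 1 - b) : ℤ) • e b) (a + 1)
      simp only [Nat.add_sub_add_right] at hr
      rw [← hr, sum_range_succ _ (a + 1), sum_range_succ _ (a + 1), add_right_comm,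
        ← sum_add_distrib]
      congr 1
      · refine sum_congr rfl fun b hb => ?_
        have hb := Nat.lt_succ_iff.1 (mem_range.1 hb)
        -- Pascal's rule needs `l + 1 - b = (l - b) + 1`; where the subtraction truncates, `e b`
        -- vanishes.
        rcases le_or_gt b l with hlb | hlb
        · rw [← add_smul, Nat.succ_sub hlb, Nat.succ_sub hb, Nat.choose_succ_succ]
          push_cast
          rw [add_comm]
        · simp [hz b hlb]
      · simp
  · rw [hl, h0]
    rintro (_ | a)
    · simp [h0]
    · rw [_root_.mainChain, glue_dotProduct_glue, hd a, hd (a + 1), Nat.choose_succ_succ]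
      push_cast; ring
  · rw [h0]; exact h.ne_zero

/-- The coefficients agree by the absorption identities `int_choose_succ` in the lower half and
`int_choose_succ_left` in the upper half. A chain with a single vector has to be excluded, since its
side chain is zero. -/
theorem IsSymmChain.sideChain {n k : ℕ} {e : ℕ → Finset (Fin n) → ℤ} (h : IsSymmChain n k e)
    (hk : 2 * k < n) : IsSymmChain (n + 1) (k + 1) (sideChain (n - 2 * k) e) := by
  have hl : n + 1 - 2 * (k + 1) = n - 2 * k - 1 := by omega
  have hz := h.eq_zero
  have hu := h.upSum_eq
  have hd := h.dot_self
  obtain ⟨l, hn⟩ : ∃ l, n - 2 * k = l + 1 := ⟨n - 2 * k - 1, by omega⟩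
  rw [hn] at hz hu hd ⊢
  have h0 : _root_.sideChain (l + 1) e 0 ⬝ᵥ _root_.sideChain (l + 1) e 0 =
      ((l : ℤ) + 1) * (l + 2) * (e 0 ⬝ᵥ e 0) := by
    rw [_root_.sideChain, glue_dotProduct_glue]
    rw [smul_dotProduct, smul_dotProduct, dotProduct_smul, dotProduct_smul, hd]
    simp only [smul_eq_mul, Nat.choose_one_right, zero_add]
    push_cast
    ring
  refine ⟨by omega, ?_, ?_, ?_, ?_, ?_⟩
  · intro a ha
    rw [_root_.sideChain, hz (a + 1) (by omega), smul_zero]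
    rcases eq_or_ne a (l + 1) with rfl | ha'
    · simp [glue_zero]
    · rw [hz a (by omega), smul_zero, glue_zero]
  · intro a X hX
    refine glue_card (r := k + 1 + a) ?_ ?_ X hX
    · intro X hX
      rw [h.card (a + 1) X (right_ne_zero_of_mul hX)]; ring
    · intro X hX
      rw [h.card a X (right_ne_zero_of_mul hX)]; ring
  · intro a
    simp only [_root_.sideChain, smul_glue, sum_glue, upSum_glue, upSum_smul, hu]
    congr 1
    -- The index is shifted so that both sides are combinations of `e b`; the added term `b = 0` has
    -- coefficient zero.
    · rw [show ∑ b ∈ range (a + 1), ((n + 1 - 2 * (k + 1) - b).choose (a - b) : ℤ) •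
          -((b : ℤ) + 1) • e (b + 1) =
          ∑ b ∈ range (a + 2), (-(b : ℤ) * ((l + 1 - b).choose (a + 1 - b) : ℤ)) • e b from ?_]
      · rw [sum_range_succ _ (a + 1), sum_range_succ _ (a + 1)]
        simp only [smul_add, smul_sum, smul_smul]
        rw [add_right_comm, ← sum_add_distrib]
        congr 1
        · refine sum_congr rfl fun b hb => ?_
          rw [← add_smul]
          have hb := mem_range.1 hb
          rcases le_or_gt b (l + 1) with hlb | hlb
          · congr 1
            have := int_choose_succ (l + 1 - b) (a - b)
            rw [show a - b + 1 = a + 1 - b by omega] at this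
            push_cast [Nat.cast_sub hlb, Nat.cast_sub (Nat.lt_succ_iff.1 hb)] at this ⊢
            linear_combination -this
          · rw [hz b hlb, smul_zero, smul_zero]
      · rw [sum_range_succ' _ (a + 1)]
        simp only [Nat.cast_zero, neg_zero, zero_mul, zero_smul, add_zero, smul_smul]
        refine sum_congr rfl fun b _ => ?_
        congr 1
        rw [hl, hn, Nat.add_sub_cancel, Nat.add_sub_add_right, Nat.add_sub_add_right]
        push_cast; ring
    · rw [smul_sum]
      refine sum_congr rfl fun b hb => ?_
      have hb := Nat.lt_succ_iff.1 (mem_range.1 hb)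
      rw [smul_smul, smul_smul, hl, hn, Nat.add_sub_cancel]
      -- At `b = l + 1` the identity does not apply, as `l - b` truncates. There both sides vanish:
      -- through the factor `l + 1 - a` if `a = b`, through the binomials otherwise.
      rcases lt_trichotomy b (l + 1) with hlb | rfl | hlb
      · congr 1
        have := int_choose_succ_left (l - b) (a - b)
        rw [show l - b + 1 = l + 1 - b by omega] at this
        push_cast [Nat.cast_sub (Nat.lt_succ_iff.1 hlb), Nat.cast_sub hb] at this ⊢
        linear_combination this
      · congr 1
        rcases hb.eq_or_lt with rfl | hb
        · simp
        · rw [Nat.sub_self, Nat.choose_eq_zero_of_lt (by omega),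
            Nat.choose_eq_zero_of_lt (by omega)]
          simp
      · rw [hz b hlb, smul_zero, smul_zero]
  · intro a
    rw [hl, hn, h0, _root_.sideChain, glue_dotProduct_glue]
    rw [smul_dotProduct, smul_dotProduct, dotProduct_smul, dotProduct_smul, hd, hd a]
    simp only [smul_eq_mul]
    have h1 := int_choose_succ (l + 1) a
    have h2 := int_choose_succ_left l a
    rw [Nat.add_sub_cancel]
    push_cast at h1 h2 ⊢
    linear_combination (e 0 ⬝ᵥ e 0) * ((a + 1 : ℤ) * h1 + (l + 2 : ℤ) * h2)
  · rw [h0]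
    have := h.ne_zero
    positivity

/-! ### The family of all chains: orthogonality and counting -/

/-- The chain of vectors `a! • e a`, `a ≤ n - 2k`. -/
def factChain {n : ℕ} (p : ℕ × (ℕ → Finset (Fin n) → ℤ)) : List (Finset (Fin n) → ℤ) :=
  (List.range (n - 2 * p.1 + 1)).map fun a => (a.factorial : ℤ) • p.2 a

/-- The starting ranks of the chains of `O(n)`, with the vectors scaled by inverse factorials. -/
def chainData : (n : ℕ) → List (ℕ × (ℕ → Finset (Fin n) → ℤ))
  | 0 => [(0, fun a _ => if a = 0 then 1 else 0)]
  | n + 1 => (chainData n).flatMap fun p =>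
      (p.1, mainChain p.2) ::
        if 2 * p.1 < n then [(p.1 + 1, sideChain (n - 2 * p.1) p.2)] else []

theorem isSymmChain_of_mem {n : ℕ} : ∀ p ∈ chainData n, IsSymmChain n p.1 p.2 := by
  induction n with
  | zero =>
    intro p hp
    rw [chainData, List.mem_singleton] at hp
    subst hp
    have hs : ∀ F : Finset (Fin 0) → ℤ, ∑ X, F X = F ∅ := fun F => by
      rw [univ_unique, sum_singleton]; rfl
    refine ⟨le_rfl, ?_, ?_, ?_, ?_, ?_⟩
    · intro a ha
      funext X
      exact if_neg (by omega)
    · intro a X hX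
      have : a = 0 := by by_contra h; exact hX (if_neg h)
      subst this
      rw [Subsingleton.elim X ∅]; rfl
    · intro a
      funext X
      rw [Subsingleton.elim X ∅, upSum, hs, sum_range_succ']
      rcases a with _ | a <;> simp
    · rintro (_ | a)
      · simp
      · simp [dotProduct]
    · simp [dotProduct]
  | succ n ih =>
    intro p hp
    rw [chainData, List.mem_flatMap] at hp
    obtain ⟨q, hq, hp⟩ := hp
    rw [List.mem_cons] at hp
    rcases hp with rfl | hp
    · exact (ih q hq).mainChain
    · split_ifs at hp with hk
      · rw [List.mem_singleton] at hp
        subst hp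
        exact (ih q hq).sideChain hk
      · simp at hp

/-- Descendants of different chains are orthogonal in each half separately. For the two descendants
of one chain, the contributions of the halves at equal rank cancel because (a + 1) C(l, a + 1) = (l
- a) C(l, a). -/
theorem chainData_pairwise (n : ℕ) :
    (chainData n).Pairwise fun p q => ∀ a b, p.2 a ⬝ᵥ q.2 b = 0 := by
  induction n with
  | zero => simp [chainData]
  | succ n ih =>
    rw [chainData, List.pairwise_flatMap]
    refine ⟨fun p hp => ?_, ?_⟩
    · split_ifs with hk
      · rw [List.pairwise_pair]
        intro a b
        have h := isSymmChain_of_mem p hp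
        have ho : ∀ c d, c ≠ d → p.2 c ⬝ᵥ p.2 d = 0 := fun c d hcd =>
          dotProduct_eq_zero_of_card (h.card c) (h.card d) (by omega)
        rcases a with _ | a
        · simp only [mainChain, sideChain, glue_dotProduct_glue, dotProduct_smul]
          rw [ho 0 (b + 1) (by omega)]
          simp
        · simp only [mainChain, sideChain, glue_dotProduct_glue, dotProduct_smul]
          rcases eq_or_ne a b with rfl | hab
          · have h1 := int_choose_succ (n - 2 * p.1) a
            rw [h.dot_self a, h.dot_self (a + 1)]
            simp only [smul_eq_mul]
            linear_combination -(p.2 0 ⬝ᵥ p.2 0) * h1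
          · rw [ho _ _ hab, ho (a + 1) (b + 1) (by omega)]
            simp
      · simp
    · refine ih.imp ?_
      intro p q hpq
      have hm : ∀ r : ℕ × (ℕ → Finset (Fin n) → ℤ), ∀ x ∈ ((r.1, mainChain r.2) ::
          if 2 * r.1 < n then [(r.1 + 1, sideChain (n - 2 * r.1) r.2)] else [] :
            List (ℕ × (ℕ → Finset (Fin (n + 1)) → ℤ))), ∀ a, ∃ (s t : ℤ) (i j : ℕ),
          x.2 a = glue (s • r.2 i) (t • r.2 j) := by
        intro r x hx a
        rw [List.mem_cons] at hx
        rcases hx with rfl | hx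
        · rcases a with _ | a
          · exact ⟨1, 0, 0, 0, by simp [mainChain]⟩
          · exact ⟨1, 1, a + 1, a, by simp [mainChain]⟩
        · split_ifs at hx
          · rw [List.mem_singleton] at hx
            subst hx
            exact ⟨_, _, a + 1, a, rfl⟩
          · simp at hx
      intro x hx y hy a b
      obtain ⟨s, t, i, j, hx⟩ := hm p x hx a
      obtain ⟨s', t', i', j', hy⟩ := hm q y hy b
      rw [hx, hy, glue_dotProduct_glue]
      simp only [smul_dotProduct, dotProduct_smul, hpq, smul_zero, add_zero]

/-- A chain starting at k yields one starting at k and, unless it is a single vector, one starting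
at k + 1, so the counts obey Pascal's recursion. The range of `k` reaches just past the middle,
where the count is zero, so that the induction can use `k + 1`. -/
theorem countP_chainData (n k : ℕ) (hk : 2 * k ≤ n + 1) :
    (chainData n).countP (fun p => p.1 = k) + (if k = 0 then 0 else n.choose (k - 1)) =
      n.choose k := by
  induction n generalizing k with
  | zero =>
    obtain rfl : k = 0 := by omega
    simp [chainData]
  | succ n ih =>
    have hc : (chainData (n + 1)).countP (fun p => p.1 = k) =
        (chainData n).countP (fun p => p.1 = k) +
          (chainData n).countP (fun p => p.1 + 1 = k ∧ 2 * p.1 < n) := by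
      rw [chainData]
      generalize chainData n = L
      induction L with
      | nil => rfl
      | cons p L ihL =>
        rw [List.flatMap_cons, List.countP_append, ihL]
        simp only [List.countP_cons]
        split_ifs with h1 h2 h3 <;> simp_all <;> omega
    rw [hc]
    rcases k with _ | k
    · have := ih 0 (by omega)
      simpa using this
    -- If `n = 2 * k`, no new chain starts at `k + 1`, and the two central binomials of `2 * k + 1`
    -- coincide.
    · rcases (show 2 * k < n ∨ n = 2 * k by omega) with h | rfl
      · have h1 := ih k (by omega)
        have h2 := ih (k + 1) (by omega)
        have : (chainData n).countP (fun p => p.1 + 1 = k + 1 ∧ 2 * p.1 < n) =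
            (chainData n).countP (fun p => p.1 = k) := by
          refine List.countP_congr fun p _ => ?_
          simp only [decide_eq_true_eq]
          omega
        rw [this]
        simp only [Nat.add_eq_zero_iff, one_ne_zero, and_false, if_false, Nat.add_sub_cancel]
          at h2 ⊢
        rw [Nat.choose_succ_succ']
        rcases k with _ | k
        · simp at h1 h2 ⊢; omega
        · simp only [Nat.add_eq_zero_iff, one_ne_zero, and_false, if_false, Nat.add_sub_cancel]
            at h1
          rw [Nat.choose_succ_succ' n k]
          omega
      · have h1 : (chainData (2 * k)).countP (fun p => p.1 = k + 1) = 0 := by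
          rw [List.countP_eq_zero]
          intro p hp
          have := (isSymmChain_of_mem p hp).le
          simp only [decide_eq_true_eq]
          omega
        have h2 : (chainData (2 * k)).countP (fun p => p.1 + 1 = k + 1 ∧ 2 * p.1 < 2 * k) = 0 := by
          rw [List.countP_eq_zero]
          intro p hp
          simp only [decide_eq_true_eq]
          omega
        rw [h1, h2]
        simp only [Nat.add_eq_zero_iff, one_ne_zero, and_false, if_false, Nat.add_sub_cancel]
        rw [zero_add, zero_add, Nat.choose_symm_half]

/-- A chain with l + 1 vectors is replaced by chains with l + 2 and l vectors, the latter absent if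
l = 0; the total doubles. -/
theorem sum_length_chainData (n : ℕ) :
    ((chainData n).map fun p => n - 2 * p.1 + 1).sum = 2 ^ n := by
  induction n with
  | zero => rfl
  | succ n ih =>
    have hle : ∀ p ∈ chainData n, 2 * p.1 ≤ n := fun p hp => (isSymmChain_of_mem p hp).le
    rw [chainData, pow_succ, ← ih]
    revert hle
    generalize chainData n = L
    intro hle
    induction L with
    | nil => rfl
    | cons p L ihL =>
      have := hle p List.mem_cons_self
      rw [List.flatMap_cons, List.map_append, List.sum_append,
        ihL fun q hq => hle q (List.mem_cons_of_mem _ hq)]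
      simp only [List.map_cons, List.sum_cons]
      split_ifs with h
      · simp
        omega
      · simp
        omega

/-! ### The output of the linear BTK algorithm on B(n) -/

/-- The restriction of a vector of `V(M(n,k₁,…,kₙ))` to `B(n)`. -/
def restrictBool {n : ℕ} (v : (Fin n → ℕ) → ℤ) : Finset (Fin n) → ℤ :=
  fun X => v fun i => if i ∈ X then 1 else 0

theorem restrictBool_layerCopy_zero {n : ℕ} (v : (Fin n → ℕ) → ℤ) :
    restrictBool (layerCopy 0 v) = glue (restrictBool v) 0 := by
  funext X
  by_cases h : Fin.last n ∈ X <;> simp [restrictBool, layerCopy, glue, h]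

theorem restrictBool_layerCopy_one {n : ℕ} (v : (Fin n → ℕ) → ℤ) :
    restrictBool (layerCopy 1 v) = glue 0 (restrictBool v) := by
  funext X
  by_cases h : Fin.last n ∈ X <;> simp [restrictBool, layerCopy, glue, h]

/-- The linear map `chainMap` of the last step of the algorithm for `B(n + 1)`. -/
def boolChainMap {n : ℕ} (x : List (Finset (Fin n) → ℤ)) (w : ℕ → ℕ → ℤ) :
    Finset (Fin (n + 1)) → ℤ :=
  ∑ i ∈ range x.length, glue (w i 0 • x.getD i 0) (w i 1 • x.getD i 0)

theorem restrictBool_chainMap {n : ℕ} (x : List ((Fin n → ℕ) → ℤ)) (w : ℕ → ℕ → ℤ) :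
    restrictBool (chainMap 1 x w) = boolChainMap (x.map restrictBool) w := by
  have h1 : ∀ i, restrictBool (x.getD i 0) = (x.map restrictBool).getD i 0 := by
    intro i
    rw [← List.getD_map (f := restrictBool)]
    rfl
  have h2 : ∀ i, restrictBool (w i 0 • layerCopy 0 (x.getD i 0) + w i 1 • layerCopy 1 (x.getD i 0))
      = glue (w i 0 • (x.map restrictBool).getD i 0) (w i 1 • (x.map restrictBool).getD i 0) := by
    intro i
    have : restrictBool (w i 0 • layerCopy 0 (x.getD i 0) + w i 1 • layerCopy 1 (x.getD i 0)) =
      w i 0 • restrictBool (layerCopy 0 (x.getD i 0)) +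
        w i 1 • restrictBool (layerCopy 1 (x.getD i 0)) := rfl
    rw [this, restrictBool_layerCopy_zero, restrictBool_layerCopy_one, smul_glue, smul_glue,
      glue_add, h1]
    simp
  rw [boolChainMap, List.length_map]
  simp only [← h2]
  funext X
  simp only [chainMap, sum_range_succ, sum_range_zero, zero_add]
  rw [Finset.sum_apply]
  exact Finset.sum_apply _ _ _

theorem boolChainMap_eq {n : ℕ} (x : List (Finset (Fin n) → ℤ)) (w : ℕ → ℕ → ℤ) :
    boolChainMap x w = glue (∑ i ∈ range x.length, w i 0 • x.getD i 0)
      (∑ i ∈ range x.length, w i 1 • x.getD i 0) :=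
  sum_glue _ _ _

theorem length_factChain {n : ℕ} (p : ℕ × (ℕ → Finset (Fin n) → ℤ)) :
    (factChain p).length = n - 2 * p.1 + 1 := by
  simp [factChain]

theorem getD_factChain {n : ℕ} {p : ℕ × (ℕ → Finset (Fin n) → ℤ)} (h : IsSymmChain n p.1 p.2)
    (i : ℕ) : (factChain p).getD i 0 = (i.factorial : ℤ) • p.2 i := by
  rcases lt_or_ge i (n - 2 * p.1 + 1) with hi | hi
  · rw [List.getD_eq_getElem _ _ (by rwa [length_factChain])]
    simp [factChain]
  · rw [List.getD_eq_default _ _ (by rwa [length_factChain]), h.eq_zero i (by omega), smul_zero]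

/-- No bound on `a` is needed: past the end of the list the default value is zero, as are the
vectors `e a` past the end of a chain. -/
theorem sum_ite_getD {V : Type*} [AddCommGroup V] (x : List V) (c : ℤ) (a : ℕ) :
    ∑ i ∈ range x.length, (if i = a then c else 0) • x.getD i 0 = c • x.getD a 0 := by
  simp only [ite_smul, zero_smul, sum_ite_eq', mem_range]
  split_ifs with h
  · rfl
  · rw [List.getD_eq_default _ _ (by omega), smul_zero]

/-- With only the layers 0 and 1, v(r) has the terms (r, 0) with coefficient 1 and (r - 1, 1) with
coefficient r; the latter turns (r - 1)! into r!. -/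
theorem boolChainMap_pairMain {n : ℕ} {p : ℕ × (ℕ → Finset (Fin n) → ℤ)}
    (h : IsSymmChain n p.1 p.2) (r : ℕ) :
    boolChainMap (factChain p) (pairMain (n - 2 * p.1) 1 r) =
      (r.factorial : ℤ) • mainChain p.2 r := by
  have h0 : ∑ i ∈ range (factChain p).length, pairMain (n - 2 * p.1) 1 r i 0 •
      (factChain p).getD i 0 = (r.factorial : ℤ) • p.2 r := by
    rw [← getD_factChain h, ← one_smul ℤ ((factChain p).getD r 0), ← sum_ite_getD]
    refine sum_congr rfl fun i hi => ?_
    rw [length_factChain, mem_range] at hi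
    congr 1
    unfold pairMain
    split_ifs with h1 h2 h2
    · subst h2; simp
    · omega
    · omega
    · rfl
  rw [boolChainMap_eq, h0]
  rcases r with _ | r
  · rw [mainChain, smul_glue]
    congr 1
    rw [smul_zero]
    refine sum_eq_zero fun i _ => ?_
    rw [pairMain, if_neg (by omega), zero_smul]
  · rw [mainChain, smul_glue]
    congr 1
    rw [Nat.factorial_succ, Nat.cast_mul, ← smul_smul, ← getD_factChain h, ← sum_ite_getD]
    refine sum_congr rfl fun i hi => ?_
    rw [length_factChain, mem_range] at hi
    congr 1
    unfold pairMain
    split_ifs with h1 h2 h2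
    · subst h2; simp
    · omega
    · omega
    · rfl

theorem boolChainMap_pairVec {n : ℕ} {p : ℕ × (ℕ → Finset (Fin n) → ℤ)}
    (h : IsSymmChain n p.1 p.2) (l r : ℕ) :
    boolChainMap (factChain p) (pairVec l 1 r 1) = (r.factorial : ℤ) • sideChain l p.2 r := by
  rw [boolChainMap_eq, sideChain, smul_glue]
  congr 1
  · rw [smul_smul, show (r.factorial : ℤ) * -((r : ℤ) + 1) = -1 * ((r + 1).factorial : ℤ) by
      rw [Nat.factorial_succ]; push_cast; ring, ← smul_smul, ← getD_factChain h, ← sum_ite_getD]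
    refine sum_congr rfl fun i _ => ?_
    congr 1
    simp [pairVec, pairUnit]
    split_ifs <;> simp
  · rw [smul_comm, ← getD_factChain h, ← sum_ite_getD]
    refine sum_congr rfl fun i _ => ?_
    congr 1
    simp [pairVec, pairUnit]

theorem pairTransfer_pairUnit {p r : ℕ} (hr : r ≤ p) :
    pairTransfer p 0 (pairUnit r 0) = pairVec (p + 1) 1 r 1 := by
  rw [pairTransfer, sum_eq_single r]
  · simp [pairUnit]
  · intro i _ hi
    simp [pairUnit, hi]
  · intro h
    exact absurd (mem_range.2 (by omega)) h

theorem pairBTK_zero_right (p : ℕ) :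
    pairBTK p 0 = [(List.range (p + 1)).map fun i => pairUnit i 0] := by
  cases p <;> simp [pairBTK]

/-- For `q = 1` the recursion of `pairBTK` ends after at most one step, at `pairBTK l 0`, whose only
chain becomes the side chain. A single vector falls under the base case `pairBTK 0 1`, which agrees
with the main chain. -/
theorem boolChainMap_pairBTK {n : ℕ} {p : ℕ × (ℕ → Finset (Fin n) → ℤ)}
    (h : IsSymmChain n p.1 p.2) :
    (pairBTK ((factChain p).length - 1) 1).map (List.map (boolChainMap (factChain p))) =
      List.map factChain ((p.1, mainChain p.2) ::
        if 2 * p.1 < n then [(p.1 + 1, sideChain (n - 2 * p.1) p.2)] else []) := by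
  have hle := h.le
  rw [length_factChain, Nat.add_sub_cancel]
  have hm : ∀ r, boolChainMap (factChain p) (pairMain (n - 2 * p.1) 1 r) =
      (r.factorial : ℤ) • mainChain p.2 r := boolChainMap_pairMain h
  have hs : ∀ l r, boolChainMap (factChain p) (pairVec l 1 r 1) =
    (r.factorial : ℤ) • sideChain l p.2 r := boolChainMap_pairVec h
  rcases Nat.eq_zero_or_pos (n - 2 * p.1) with h0 | h0
  · rw [if_neg (by omega), h0]
    rw [h0] at hm
    have hn : n + 1 - 2 * p.1 + 1 = 2 := by omega
    have e0 : pairMain 0 1 0 = pairUnit 0 0 := by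
      funext i j
      unfold pairMain pairUnit
      split_ifs with h1 h2 h2
      · rw [h2.1]; simp
      · omega
      · omega
      · rfl
    have e1 : pairMain 0 1 1 = pairUnit 0 1 := by
      funext i j
      unfold pairMain pairUnit
      split_ifs with h1 h2 h2
      · rw [h2.1]; simp
      · omega
      · omega
      · rfl
    have m0 := hm 0
    have m1 := hm 1
    rw [e0] at m0
    rw [e1] at m1
    have hp : pairBTK 0 1 = [[pairUnit 0 0, pairUnit 0 1]] := rfl
    have hf : factChain (n := n + 1) (p.1, mainChain p.2) =
        [((0).factorial : ℤ) • mainChain p.2 0, ((1).factorial : ℤ) • mainChain p.2 1] := by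
      rw [factChain, hn]
      rfl
    rw [hp, List.map_singleton, List.map_singleton, hf, ← m0, ← m1]
    rfl
  · obtain ⟨l, hl⟩ : ∃ l, n - 2 * p.1 = l + 1 := ⟨n - 2 * p.1 - 1, by omega⟩
    rw [if_pos (by omega), hl, show pairBTK (l + 1) 1 = (List.range (l + 0 + 3)).map
      (pairMain (l + 1) 1) :: (pairBTK l 0).map (List.map (pairTransfer l 0)) from rfl,
      pairBTK_zero_right]
    rw [hl] at hm
    simp only [List.map_cons, List.map_nil, List.map_map]
    congr 1
    · conv_rhs => rw [factChain, show n + 1 - 2 * p.1 + 1 = l + 0 + 3 by omega]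
      exact List.map_congr_left fun r _ => hm r
    · congr 1
      conv_rhs => rw [factChain, show n + 1 - 2 * (p.1 + 1) + 1 = l + 1 by omega]
      refine List.map_congr_left fun r hr => ?_
      simp only [Function.comp_apply]
      rw [pairTransfer_pairUnit (by rw [List.mem_range] at hr; omega), hs]

theorem boolChains_eq (n : ℕ) : boolChains n = (chainData n).map factChain := by
  have hb : ∀ n, boolChains n = (linearBTK n fun _ => 1).map (List.map restrictBool) :=
    fun _ => rfl
  induction n with
  | zero =>
    rw [hb]
    simp [linearBTK, chainData, factChain]
    rfl
  | succ n ih =>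
    rw [hb] at ih ⊢
    rw [linearBTK, List.map_flatMap, chainData, List.map_flatMap]
    have h1 : ∀ x ∈ linearBTK n (fun _ => 1), List.map (List.map restrictBool)
        ((pairBTK (x.length - 1) 1).map (List.map (chainMap 1 x))) =
        (pairBTK ((x.map restrictBool).length - 1) 1).map
          (List.map (boolChainMap (x.map restrictBool))) := by
      intro x _
      simp only [List.map_map, List.length_map]
      refine List.map_congr_left fun c _ => ?_
      simp only [Function.comp_apply, List.map_map]
      exact List.map_congr_left fun w _ => restrictBool_chainMap x w
    rw [List.flatMap_congr h1]
    rw [← List.flatMap_map (f := List.map restrictBool) (g := fun c =>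
      (pairBTK (c.length - 1) 1).map (List.map (boolChainMap c))), ih, List.flatMap_map]
    exact List.flatMap_congr fun p hp => boolChainMap_pairBTK (isSymmChain_of_mem p hp)

/-! ### Sorting the chains by starting rank -/

theorem factChain_headD {n : ℕ} (p : ℕ × (ℕ → Finset (Fin n) → ℤ)) :
    (factChain p).headD 0 = p.2 0 := by
  rw [factChain, List.range_succ_eq_map]
  simp

theorem factChain_getLastD {n : ℕ} (p : ℕ × (ℕ → Finset (Fin n) → ℤ)) :
    (factChain p).getLastD 0 = ((n - 2 * p.1).factorial : ℤ) • p.2 (n - 2 * p.1) := by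
  rw [factChain, List.range_succ]
  simp

theorem IsSymmChain.dot_self_pos {n k : ℕ} {e : ℕ → Finset (Fin n) → ℤ} (h : IsSymmChain n k e)
    {a : ℕ} (ha : a ≤ n - 2 * k) : 0 < e a ⬝ᵥ e a := by
  have h0 : 0 ≤ e 0 ⬝ᵥ e 0 := sum_nonneg fun X _ => mul_self_nonneg _
  have h1 : 0 < e 0 ⬝ᵥ e 0 := lt_of_le_of_ne h0 h.ne_zero.symm
  rw [h.dot_self]
  have : 0 < (n - 2 * k).choose a := Nat.choose_pos ha
  positivity

theorem IsSymmChain.hasRank {n k : ℕ} {e : ℕ → Finset (Fin n) → ℤ} (h : IsSymmChain n k e)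
    {a : ℕ} (ha : a ≤ n - 2 * k) : HasRank ((a.factorial : ℤ) • e a) (k + a) := by
  refine ⟨fun h0 => ?_, fun X hX => h.card a X (right_ne_zero_of_mul hX)⟩
  rcases smul_eq_zero.1 h0 with h0 | h0
  · exact a.factorial_ne_zero (by exact_mod_cast h0)
  · have := h.dot_self_pos ha
    rw [h0] at this
    simp at this

theorem HasRank.unique {n r s : ℕ} {v : Finset (Fin n) → ℤ} (hr : HasRank v r)
    (hs : HasRank v s) : r = s := by
  obtain ⟨X, hX⟩ := Function.ne_iff.1 hr.1
  exact (hr.2 X hX).symm.trans (hs.2 X hX)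

theorem chainsFrom_eq (n k : ℕ) :
    chainsFrom n k = ((chainData n).filter fun p => p.1 = k).map factChain := by
  rw [chainsFrom, boolChains_eq, List.filter_map]
  congr 1
  refine List.filter_congr fun p hp => ?_
  have h := isSymmChain_of_mem p hp
  have h0 : HasRank (p.2 0) p.1 := by simpa using h.hasRank (Nat.zero_le _)
  have h1 := h.hasRank le_rfl
  rw [Function.comp_apply, factChain_headD, factChain_getLastD, decide_eq_decide]
  have hle := h.le
  constructor
  · rintro ⟨h2, -⟩
    exact h0.unique h2
  · rintro rfl
    exact ⟨h0, by rwa [show n - p.1 = p.1 + (n - 2 * p.1) by omega]⟩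

theorem length_chainsFrom {n k : ℕ} (hk : 2 * k ≤ n) :
    (chainsFrom n k).length = chainCount n k := by
  have := countP_chainData n k (by omega)
  rw [chainsFrom_eq, List.length_map, ← List.countP_eq_length_filter, chainCount, ← this]
  omega

/-- Equal chains at different positions would have a common first vector orthogonal to itself. This
makes different labels `b` stand for different, hence orthogonal, chains. -/
theorem boolChains_nodup (n : ℕ) : (boolChains n).Nodup := by
  rw [boolChains_eq, List.Nodup, List.pairwise_map]
  refine (chainData_pairwise n).imp_of_mem ?_
  intro p q hp hq hpq heq
  have h := congrArg (fun c => c.headD 0) heq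
  simp only [factChain_headD] at h
  have h2 := hpq 0 0
  rw [← h] at h2
  exact (isSymmChain_of_mem p hp).ne_zero h2

theorem exists_isSymmChain {n : ℕ} (σ : ChainOrder n) :
    ∃ e : (k : Fin (n / 2 + 1)) → Fin (chainCount n k) → ℕ → Finset (Fin n) → ℤ,
      (∀ (k : Fin (n / 2 + 1)) b, IsSymmChain n k (e k b)) ∧
      (∀ (k : Fin (n / 2 + 1)) b, (chainsFrom n k).get (σ k b) = factChain ((k : ℕ), e k b)) ∧
      (∀ k b b', b ≠ b' → ∀ a a', e k b a ⬝ᵥ e k b' a' = 0) ∧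
      ∀ k k', k ≠ k' → ∀ b b' a a', e k b a ⬝ᵥ e k' b' a' = 0 := by
  have hex : ∀ (k : Fin (n / 2 + 1)) (b : Fin (chainCount n k)),
      ∃ e, ((k : ℕ), e) ∈ chainData n ∧
        (chainsFrom n k).get (σ k b) = factChain ((k : ℕ), e) := by
    intro k b
    have h := List.get_mem (chainsFrom n k) (σ k b)
    generalize (chainsFrom n k).get (σ k b) = c at h ⊢
    rw [chainsFrom_eq, List.mem_map] at h
    obtain ⟨p, hp, rfl⟩ := h
    rw [List.mem_filter, decide_eq_true_eq] at hp
    obtain ⟨hp, hk⟩ := hp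
    exact ⟨p.2, by rw [← hk]; exact hp, by rw [← hk]⟩
  choose e he hc using hex
  have hort : ∀ p ∈ chainData n, ∀ q ∈ chainData n, p ≠ q → ∀ a b, p.2 a ⬝ᵥ q.2 b = 0 := by
    intro p hp q hq hpq
    have : Std.Symm fun p q : ℕ × (ℕ → Finset (Fin n) → ℤ) => ∀ a b, p.2 a ⬝ᵥ q.2 b = 0 :=
      ⟨fun p q h a b => by rw [dotProduct_comm, h]⟩
    exact (chainData_pairwise n).forall hp hq hpq
  refine ⟨e, fun k b => isSymmChain_of_mem _ (he k b), hc, ?_, ?_⟩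
  · intro k b b' hb a a'
    refine hort _ (he k b) _ (he k b') (fun heq => hb ?_) a a'
    have h := congrArg factChain heq
    rw [← hc, ← hc] at h
    exact (σ k).injective ((List.nodup_iff_injective_get.1
      ((boolChains_nodup n).sublist List.filter_sublist)) h)
  · intro k k' hk b b' a a'
    refine hort _ (he k b) _ (he k' b') (fun heq => hk ?_) a a'
    exact Fin.ext (congrArg (fun p => p.1) heq)

theorem sum_countP_mul {α : Type*} (L : List (ℕ × α)) (m : ℕ) (f : ℕ → ℕ)
    (h : ∀ p ∈ L, p.1 ≤ m) :
    ∑ k : Fin (m + 1), L.countP (fun p => p.1 = (k : ℕ)) * f k = (L.map fun p => f p.1).sum := by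
  induction L with
  | nil => simp
  | cons p L ih =>
    have hp := h p List.mem_cons_self
    simp only [List.countP_cons, add_mul, sum_add_distrib, List.map_cons, List.sum_cons]
    rw [ih fun q hq => h q (List.mem_cons_of_mem _ hq), add_comm]
    congr 1
    rw [sum_eq_single (⟨p.1, by omega⟩ : Fin (m + 1))]
    · simp
    · intro k _ hk
      have : p.1 ≠ k := fun h => hk (Fin.ext h.symm)
      simp [this]
    · simp

/-- This makes `N(n)` square, so that orthonormal columns suffice for unitarity. -/
theorem card_chainIdx (n : ℕ) : Fintype.card (ChainIdx n) = 2 ^ n := by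
  rw [Fintype.card_sigma, ← sum_length_chainData,
    ← sum_countP_mul (chainData n) (n / 2) fun k => n - 2 * k + 1]
  · refine sum_congr rfl fun k _ => ?_
    have hk : (k : ℕ) ≤ n / 2 := Nat.lt_succ_iff.1 k.2
    rw [Fintype.card_prod, card_blockIdx hk, Fintype.card_fin,
      ← length_chainsFrom (by omega), chainsFrom_eq, List.length_map,
      ← List.countP_eq_length_filter]
  · intro p hp
    have := (isSymmChain_of_mem p hp).le
    omega

/-! ### The orthonormal basis and the unitary matrix N(n) -/

theorem ChainIdx.bounds {n : ℕ} (s : ChainIdx n) :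
    2 * (s.1 : ℕ) ≤ n ∧ (s.1 : ℕ) ≤ s.2.2 ∧ (s.2.2 : ℕ) ≤ n - s.1 := by
  have h1 := Nat.lt_succ_iff.1 s.1.2
  have h2 := mem_Icc.1 s.2.2.2
  exact ⟨by omega, h2.1, h2.2⟩

/-- The vectors `a! • e k b a` form the `b`-th chain of `O(n)` from rank `k` to rank `n - k`. -/
structure IsChainBasis {n : ℕ} (σ : ChainOrder n)
    (e : (k : Fin (n / 2 + 1)) → Fin (chainCount n k) → ℕ → Finset (Fin n) → ℤ) : Prop where
  chain : ∀ (k : Fin (n / 2 + 1)) b, IsSymmChain n k (e k b)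
  get_eq : ∀ (k : Fin (n / 2 + 1)) b, (chainsFrom n k).get (σ k b) = factChain ((k : ℕ), e k b)
  dot_of_ne : ∀ k b b', b ≠ b' → ∀ a a', e k b a ⬝ᵥ e k b' a' = 0
  dot_of_rank_ne : ∀ k k', k ≠ k' → ∀ b b' a a', e k b a ⬝ᵥ e k' b' a' = 0

theorem exists_isChainBasis {n : ℕ} (σ : ChainOrder n) : ∃ e, IsChainBasis σ e :=
  let ⟨e, h1, h2, h3, h4⟩ := exists_isSymmChain σ
  ⟨e, h1, h2, h3, h4⟩

/-- The position of an index in its chain. -/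
def ChainIdx.pos {n : ℕ} (s : ChainIdx n) : ℕ := s.2.2.1 - s.1

theorem ChainIdx.pos_le {n : ℕ} (s : ChainIdx n) : s.pos ≤ n - 2 * s.1 := by
  have := s.bounds
  unfold pos
  omega

theorem ChainIdx.add_pos {n : ℕ} (s : ChainIdx n) : (s.1 : ℕ) + s.pos = s.2.2.1 := by
  have := s.bounds
  unfold pos
  omega

namespace IsChainBasis

variable {n : ℕ} {σ : ChainOrder n}
  {e : (k : Fin (n / 2 + 1)) → Fin (chainCount n k) → ℕ → Finset (Fin n) → ℤ}

theorem basisVec_eq (h : IsChainBasis σ e) (s : ChainIdx n) :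
    basisVec σ s = (s.pos.factorial : ℤ) • e s.1 s.2.1 s.pos := by
  rw [basisVec, h.get_eq, getD_factChain (h.chain _ _)]
  rfl

theorem hasRank (h : IsChainBasis σ e) (s : ChainIdx n) : HasRank (basisVec σ s) s.2.2.1 := by
  rw [h.basisVec_eq, ← s.add_pos]
  exact (h.chain _ _).hasRank s.pos_le

theorem dot_self_pos (h : IsChainBasis σ e) (s : ChainIdx n) :
    0 < e s.1 s.2.1 s.pos ⬝ᵥ e s.1 s.2.1 s.pos :=
  (h.chain _ _).dot_self_pos s.pos_le

theorem dot_eq_zero (h : IsChainBasis σ e) {s s' : ChainIdx n} (hs : s ≠ s') :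
    e s.1 s.2.1 s.pos ⬝ᵥ e s'.1 s'.2.1 s'.pos = 0 := by
  by_cases hk : s.1 = s'.1
  · obtain ⟨k, b, i⟩ := s
    obtain ⟨k', b', i'⟩ := s'
    obtain rfl : k = k' := hk
    by_cases hb : b = b'
    · subst hb
      refine dotProduct_eq_zero_of_card ((h.chain k b).card _) ((h.chain k b).card _) ?_
      rw [ChainIdx.add_pos ⟨k, b, i⟩, ChainIdx.add_pos ⟨k, b, i'⟩]
      intro hi
      obtain rfl : i = i' := Subtype.ext hi
      exact hs rfl
    · exact h.dot_of_ne k b b' hb _ _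
  · exact h.dot_of_rank_ne _ _ hk _ _ _ _

theorem basisVec_injective (h : IsChainBasis σ e) : Function.Injective (basisVec σ) := by
  intro s s' hs
  by_contra hne
  have h0 := h.dot_eq_zero hne
  have h1 : basisVec σ s ⬝ᵥ basisVec σ s' = 0 := by
    rw [h.basisVec_eq, h.basisVec_eq, smul_dotProduct, dotProduct_smul, h0]
    simp
  rw [← hs, dotProduct_self_eq_zero] at h1
  exact (h.hasRank s).1 h1

theorem range_basisVec (h : IsChainBasis σ e) :
    Set.range (basisVec σ) = {v | ∃ c ∈ boolChains n, v ∈ c} := by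
  ext v
  constructor
  · rintro ⟨s, rfl⟩
    refine ⟨(chainsFrom n s.1).get (σ s.1 s.2.1), ?_, ?_⟩
    · exact (List.mem_filter.1 (List.get_mem (chainsFrom n s.1) (σ s.1 s.2.1))).1
    · rw [h.get_eq, h.basisVec_eq, factChain]
      exact List.mem_map.2 ⟨s.pos, List.mem_range.2 (Nat.lt_succ_of_le s.pos_le), rfl⟩
  · rintro ⟨c, hc, hv⟩
    rw [boolChains_eq, List.mem_map] at hc
    obtain ⟨p, hp, rfl⟩ := hc
    have hle := (isSymmChain_of_mem p hp).le
    have hmem : factChain p ∈ chainsFrom n p.1 := by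
      rw [chainsFrom_eq]
      exact List.mem_map.2 ⟨p, List.mem_filter.2 ⟨hp, by simp⟩, rfl⟩
    obtain ⟨i, hi⟩ := List.get_of_mem hmem
    let k : Fin (n / 2 + 1) := ⟨p.1, by omega⟩
    rw [factChain, List.mem_map] at hv
    obtain ⟨a, ha, rfl⟩ := hv
    rw [List.mem_range] at ha
    refine ⟨⟨k, (σ k).symm i, ⟨p.1 + a, mem_Icc.2 ⟨by simp [k], by simp only [k]; omega⟩⟩⟩, ?_⟩
    have hg : (chainsFrom n k).get (σ k ((σ k).symm i)) = factChain p := by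
      rw [Equiv.apply_symm_apply]; exact hi
    unfold basisVec
    rw [hg, getD_factChain (isSymmChain_of_mem p hp)]
    simp [k]

/-- Normalization cancels the factorials, so the vectors `e` can be used from here on. -/
theorem matN_apply (h : IsChainBasis σ e) (X : Finset (Fin n)) (s : ChainIdx n) :
    matN σ X s = (e s.1 s.2.1 s.pos X : ℝ) /
      Real.sqrt ((e s.1 s.2.1 s.pos ⬝ᵥ e s.1 s.2.1 s.pos : ℤ) : ℝ) := by
  have hf : (0 : ℝ) < (s.pos.factorial : ℝ) := by exact_mod_cast s.pos.factorial_pos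
  have h1 : ∑ Y, (basisVec σ s Y : ℝ) ^ 2 = (s.pos.factorial : ℝ) ^ 2 *
      ((e s.1 s.2.1 s.pos ⬝ᵥ e s.1 s.2.1 s.pos : ℤ) : ℝ) := by
    rw [h.basisVec_eq, dotProduct]
    push_cast [Pi.smul_apply, smul_eq_mul]
    rw [mul_sum]
    exact sum_congr rfl fun Y _ => by ring
  rw [matN, Matrix.of_apply, h1, Real.sqrt_mul (sq_nonneg _), Real.sqrt_sq hf.le, h.basisVec_eq]
  push_cast [Pi.smul_apply, smul_eq_mul]
  rw [mul_div_mul_left _ _ hf.ne']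

theorem matNC_apply (h : IsChainBasis σ e) (X : Finset (Fin n)) (s : ChainIdx n) :
    matNC σ X s = (e s.1 s.2.1 s.pos X : ℂ) /
      ((Real.sqrt ((e s.1 s.2.1 s.pos ⬝ᵥ e s.1 s.2.1 s.pos : ℤ) : ℝ) : ℝ) : ℂ) := by
  rw [matNC, Matrix.map_apply, h.matN_apply]
  push_cast
  rfl

theorem conjN_apply (h : IsChainBasis σ e) (M : Matrix (Finset (Fin n)) (Finset (Fin n)) ℂ)
    (s s' : ChainIdx n) :
    conjN σ M s s' = (∑ X, ∑ Y, (e s.1 s.2.1 s.pos X : ℂ) * M X Y * (e s'.1 s'.2.1 s'.pos Y : ℂ)) /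
      ((Real.sqrt ((e s.1 s.2.1 s.pos ⬝ᵥ e s.1 s.2.1 s.pos : ℤ) : ℝ) *
        Real.sqrt ((e s'.1 s'.2.1 s'.pos ⬝ᵥ e s'.1 s'.2.1 s'.pos : ℤ) : ℝ) : ℝ) : ℂ) := by
  rw [conjN, Matrix.mul_apply]
  simp only [Matrix.mul_apply, Matrix.conjTranspose_apply, h.matNC_apply, sum_mul, sum_div]
  rw [sum_comm]
  refine sum_congr rfl fun X _ => sum_congr rfl fun Y _ => ?_
  have : star ((e s.1 s.2.1 s.pos X : ℂ) /
      ((Real.sqrt ((e s.1 s.2.1 s.pos ⬝ᵥ e s.1 s.2.1 s.pos : ℤ) : ℝ) : ℝ) : ℂ)) =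
      (e s.1 s.2.1 s.pos X : ℂ) /
      ((Real.sqrt ((e s.1 s.2.1 s.pos ⬝ᵥ e s.1 s.2.1 s.pos : ℤ) : ℝ) : ℝ) : ℂ) := by
    simp
  rw [this]
  push_cast
  ring

theorem conjTranspose_mul_self (h : IsChainBasis σ e) :
    (matNC σ).conjTranspose * matNC σ = 1 := by
  ext s s'
  have h1 : ((matNC σ).conjTranspose * matNC σ) s s' = conjN σ 1 s s' := by
    rw [conjN, Matrix.mul_one]
  have h2 : ∑ X, ∑ Y, (e s.1 s.2.1 s.pos X : ℂ) * (1 : Matrix _ _ ℂ) X Y *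
      (e s'.1 s'.2.1 s'.pos Y : ℂ) = ((e s.1 s.2.1 s.pos ⬝ᵥ e s'.1 s'.2.1 s'.pos : ℤ) : ℂ) := by
    rw [dotProduct]
    push_cast
    refine sum_congr rfl fun X _ => ?_
    simp [Matrix.one_apply]
  rw [h1, h.conjN_apply, h2]
  by_cases hs : s = s'
  · subst hs
    have hpos : (0 : ℝ) < ((e s.1 s.2.1 s.pos ⬝ᵥ e s.1 s.2.1 s.pos : ℤ) : ℝ) := by
      exact_mod_cast h.dot_self_pos s
    rw [Real.mul_self_sqrt hpos.le, Matrix.one_apply_eq, Complex.ofReal_intCast, div_self]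
    exact_mod_cast hpos.ne'
  · rw [h.dot_eq_zero hs, Matrix.one_apply_ne hs]
    simp

theorem mul_conjTranspose_self (h : IsChainBasis σ e) :
    matNC σ * (matNC σ).conjTranspose = 1 := by
  have hcard : Fintype.card (Finset (Fin n)) = Fintype.card (ChainIdx n) := by
    rw [card_chainIdx, Fintype.card_finset, Fintype.card_fin]
  exact (Matrix.mul_eq_one_comm_of_card_eq _ _ _ hcard.symm).1 h.conjTranspose_mul_self

end IsChainBasis

/-! ### Subset-sum matrices in the chain basis -/

/-- The matrix whose entry at `(X, Y)`, with `|X| = i` and `|Y| = j`, is the sum of `f |Z|` over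
`Z ⊆ X ∩ Y`. -/
def subsetSumMatrix (n i j : ℕ) (f : ℕ → ℂ) : Matrix (Finset (Fin n)) (Finset (Fin n)) ℂ :=
  Matrix.of fun X Y => if X.card = i ∧ Y.card = j then ∑ Z ∈ (X ∩ Y).powerset, f Z.card else 0

theorem subsetSumMatrix_mem (n i j : ℕ) (f : ℕ → ℂ) : subsetSumMatrix n i j f ∈ terwilliger n := by
  intro π X Y
  simp only [subsetSumMatrix, Matrix.of_apply, card_map, ← Finset.map_inter,
    sum_powerset_apply_card]

/-- Since Z ⊆ X ∩ Y means Z ⊆ X and Z ⊆ Y, exchanging the sums leaves a diagonal form in the two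
superset sums. -/
theorem sum_subsetSumMatrix {n r s : ℕ} {v w : Finset (Fin n) → ℤ} (i j : ℕ) (f : ℕ → ℂ)
    (hv : ∀ X, v X ≠ 0 → X.card = r) (hw : ∀ X, w X ≠ 0 → X.card = s) :
    ∑ X, ∑ Y, (v X : ℂ) * subsetSumMatrix n i j f X Y * (w Y : ℂ) =
      if r = i ∧ s = j then ∑ Z, f Z.card * (upSum v Z : ℂ) * (upSum w Z : ℂ) else 0 := by
  split_ifs with h
  · obtain ⟨rfl, rfl⟩ := h
    have h1 : ∀ X Y, (v X : ℂ) * subsetSumMatrix n r s f X Y * (w Y : ℂ) =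
        ∑ Z, f Z.card * ((if Z ⊆ X then v X else 0 : ℤ) : ℂ) *
          ((if Z ⊆ Y then w Y else 0 : ℤ) : ℂ) := by
      intro X Y
      by_cases hX : v X = 0
      · simp [hX]
      by_cases hY : w Y = 0
      · simp [hY]
      rw [subsetSumMatrix, Matrix.of_apply, if_pos ⟨hv X hX, hw Y hY⟩, mul_sum, sum_mul,
        ← sum_subset (subset_univ (X ∩ Y).powerset)]
      · refine sum_congr rfl fun Z hZ => ?_
        rw [mem_powerset, subset_inter_iff] at hZ
        rw [if_pos hZ.1, if_pos hZ.2]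
        ring
      · intro Z _ hZ
        rw [mem_powerset, subset_inter_iff, not_and_or] at hZ
        rcases hZ with hZ | hZ <;> simp [hZ]
    simp only [h1, upSum]
    push_cast
    simp only [mul_sum, sum_mul]
    rw [sum_congr rfl fun X _ => sum_comm, sum_comm]
    exact sum_congr rfl fun Z _ => sum_comm
  · refine sum_eq_zero fun X _ => sum_eq_zero fun Y _ => ?_
    by_cases hX : v X = 0
    · simp [hX]
    by_cases hY : w Y = 0
    · simp [hY]
    rw [subsetSumMatrix, Matrix.of_apply, hv X hX, hw Y hY, if_neg h]
    simp

theorem sum_weight_mul {n k : ℕ} {v w : Finset (Fin n) → ℤ} (f : ℕ → ℂ)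
    (hv : ∀ X, v X ≠ 0 → X.card = k) :
    ∑ Z, f Z.card * (v Z : ℂ) * (w Z : ℂ) = f k * ((v ⬝ᵥ w : ℤ) : ℂ) := by
  rw [dotProduct]
  push_cast
  rw [mul_sum]
  refine sum_congr rfl fun Z _ => ?_
  by_cases hZ : v Z = 0
  · simp [hZ]
  · rw [hv Z hZ, mul_assoc]

theorem IsSymmChain.sum_upSum {n k k' : ℕ} {e e' : ℕ → Finset (Fin n) → ℤ}
    (h : IsSymmChain n k e) (h' : IsSymmChain n k' e') (f : ℕ → ℂ) (a a' : ℕ) :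
    ∑ Z, f Z.card * (upSum (e a) Z : ℂ) * (upSum (e' a') Z : ℂ) =
      ∑ c ∈ range (a + 1), ∑ d ∈ range (a' + 1), ((n - 2 * k - c).choose (a - c) : ℂ) *
        ((n - 2 * k' - d).choose (a' - d) : ℂ) * f (k + c) * ((e c ⬝ᵥ e' d : ℤ) : ℂ) := by
  have h1 : ∀ c d, f (k + c) * ((e c ⬝ᵥ e' d : ℤ) : ℂ) =
    ∑ Z, f Z.card * (e c Z : ℂ) * (e' d Z : ℂ) := fun c d => (sum_weight_mul f (h.card c)).symm
  simp only [mul_assoc] at h1 ⊢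
  simp only [h1, h.upSum_eq a, h'.upSum_eq a', Finset.sum_apply, Pi.smul_apply, smul_eq_mul]
  push_cast
  simp only [mul_sum, sum_mul]
  rw [sum_comm]
  conv_rhs => rw [sum_comm]
  refine sum_congr rfl fun d _ => ?_
  rw [sum_comm]
  exact sum_congr rfl fun c _ => sum_congr rfl fun Z _ => by ring

/-- Vectors of different rank are orthogonal, so only the diagonal terms `c = d` of
`IsSymmChain.sum_upSum` survive. -/
theorem IsSymmChain.sum_upSum_self {n k : ℕ} {e : ℕ → Finset (Fin n) → ℤ}
    (h : IsSymmChain n k e) (f : ℕ → ℂ) (a a' : ℕ) :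
    ∑ Z, f Z.card * (upSum (e a) Z : ℂ) * (upSum (e a') Z : ℂ) =
      (∑ c ∈ range (min a a' + 1), ((n - 2 * k - c).choose (a - c) : ℂ) *
        ((n - 2 * k - c).choose (a' - c) : ℂ) * ((n - 2 * k).choose c : ℂ) * f (k + c)) *
          ((e 0 ⬝ᵥ e 0 : ℤ) : ℂ) := by
  rw [h.sum_upSum h, sum_mul]
  have hsub : range (min a a' + 1) ⊆ range (a + 1) := range_subset_range.2 (by omega)
  rw [← sum_subset hsub]
  · refine sum_congr rfl fun c hc => ?_
    rw [mem_range] at hc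
    rw [sum_eq_single c]
    · rw [h.dot_self c]
      push_cast
      ring
    · intro d _ hd
      rw [dotProduct_eq_zero_of_card (h.card c) (h.card d) (by omega)]
      simp
    · intro hc'
      exact absurd (mem_range.2 (by omega)) hc'
  · intro c hc hc'
    rw [mem_range] at hc hc'
    refine sum_eq_zero fun d hd => ?_
    rw [mem_range] at hd
    rw [dotProduct_eq_zero_of_card (h.card c) (h.card d) (by omega)]
    simp

/-! ### Repeated blocks -/

theorem repeatBlocks_apply_same {n : ℕ} (B : BlockAlg n) (k : Fin (n / 2 + 1))
    (b b' : Fin (chainCount n k)) (i j : BlockIdx n k) :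
    repeatBlocks B ⟨k, b, i⟩ ⟨k, b', j⟩ = if b = b' then B k i j else 0 := by
  rw [repeatBlocks, Matrix.blockDiagonal'_apply_eq, Matrix.kroneckerMap_apply, Matrix.one_apply]
  split_ifs <;> simp

theorem repeatBlocks_apply_of_ne {n : ℕ} (B : BlockAlg n) {k k' : Fin (n / 2 + 1)} (hk : k ≠ k')
    (x : Fin (chainCount n k) × BlockIdx n k) (y : Fin (chainCount n k') × BlockIdx n k') :
    repeatBlocks B ⟨k, x⟩ ⟨k', y⟩ = 0 :=
  Matrix.blockDiagonal'_apply_ne _ _ _ hk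

theorem dropBlocks_repeatBlocks {n : ℕ} (B : BlockAlg n) : dropBlocks (repeatBlocks B) = B := by
  funext k
  ext i j
  rw [dropBlocks, Matrix.of_apply, repeatBlocks_apply_same, if_pos rfl]

theorem repeatBlocks_add {n : ℕ} (B C : BlockAlg n) :
    repeatBlocks (B + C) = repeatBlocks B + repeatBlocks C := by
  ext ⟨k, b, i⟩ ⟨k', b', j⟩
  rw [Matrix.add_apply]
  by_cases hk : k = k'
  · subst hk
    simp only [repeatBlocks_apply_same]
    split_ifs <;> simp
  · simp only [repeatBlocks_apply_of_ne _ hk, add_zero]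

theorem repeatBlocks_smul {n : ℕ} (c : ℂ) (B : BlockAlg n) :
    repeatBlocks (c • B) = c • repeatBlocks B := by
  ext ⟨k, b, i⟩ ⟨k', b', j⟩
  rw [Matrix.smul_apply]
  by_cases hk : k = k'
  · subst hk
    simp only [repeatBlocks_apply_same]
    split_ifs <;> simp
  · simp only [repeatBlocks_apply_of_ne _ hk, smul_zero]

theorem repeatBlocks_mul {n : ℕ} (B C : BlockAlg n) :
    repeatBlocks (B * C) = repeatBlocks B * repeatBlocks C := by
  unfold repeatBlocks
  rw [← Matrix.blockDiagonal'_mul]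
  congr 1
  funext k
  rw [Pi.mul_apply, ← Matrix.mul_kronecker_mul, Matrix.one_mul]

theorem repeatBlocks_star {n : ℕ} (B : BlockAlg n) :
    repeatBlocks (star B) = (repeatBlocks B).conjTranspose := by
  ext ⟨k, b, i⟩ ⟨k', b', j⟩
  rw [Matrix.conjTranspose_apply]
  by_cases hk : k = k'
  · subst hk
    simp only [repeatBlocks_apply_same, eq_comm (a := b')]
    split_ifs <;> simp
  · simp only [repeatBlocks_apply_of_ne _ hk, repeatBlocks_apply_of_ne _ (Ne.symm hk), star_zero]

/-- `repeatBlocks` as a linear map. -/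
def repeatBlocksLin (n : ℕ) : BlockAlg n →ₗ[ℂ] Matrix (ChainIdx n) (ChainIdx n) ℂ where
  toFun := repeatBlocks
  map_add' := repeatBlocks_add
  map_smul' := repeatBlocks_smul

/-- `conjN` as a linear map. -/
noncomputable def conjNLin {n : ℕ} (σ : ChainOrder n) :
    Matrix (Finset (Fin n)) (Finset (Fin n)) ℂ →ₗ[ℂ] Matrix (ChainIdx n) (ChainIdx n) ℂ where
  toFun := conjN σ
  map_add' M M' := by rw [conjN, Matrix.mul_add, Matrix.add_mul]; rfl
  map_smul' c M := by rw [conjN, Matrix.mul_smul, Matrix.smul_mul]; rfl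

/-- The nonzero entry of the `k`-th block of `subsetSumMatrix n i j f`. -/
noncomputable def blockCoef (n i j : ℕ) (f : ℕ → ℂ) (k : ℕ) : ℂ :=
  (∑ c ∈ range (min (i - k) (j - k) + 1), ((n - 2 * k - c).choose (i - k - c) : ℂ) *
    ((n - 2 * k - c).choose (j - k - c) : ℂ) * ((n - 2 * k).choose c : ℂ) * f (k + c)) /
  ((Real.sqrt ((n - 2 * k).choose (i - k)) * Real.sqrt ((n - 2 * k).choose (j - k)) : ℝ) : ℂ)

/-- The blocks of `subsetSumMatrix n i j f`. -/
noncomputable def subsetSumBlocks (n i j : ℕ) (f : ℕ → ℂ) : BlockAlg n := fun k =>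
  Matrix.of fun r s => if r.1 = i ∧ s.1 = j then blockCoef n i j f k else 0

/-- Different chains do not interact, as superset sums stay in the span of a chain. Within one
chain, the squared length of `e k b 0` is a common factor of numerator and denominator; it cancels,
so the block does not depend on `b`. -/
theorem IsChainBasis.conjN_subsetSumMatrix {n : ℕ} {σ : ChainOrder n}
    {e : (k : Fin (n / 2 + 1)) → Fin (chainCount n k) → ℕ → Finset (Fin n) → ℤ}
    (h : IsChainBasis σ e) (i j : ℕ) (f : ℕ → ℂ) :
    conjN σ (subsetSumMatrix n i j f) = repeatBlocks (subsetSumBlocks n i j f) := by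
  ext s s'
  rw [h.conjN_apply, sum_subsetSumMatrix i j f ((h.chain s.1 s.2.1).card s.pos)
    ((h.chain s'.1 s'.2.1).card s'.pos), s.add_pos, s'.add_pos]
  have hzero : (∀ a a', e s.1 s.2.1 a ⬝ᵥ e s'.1 s'.2.1 a' = 0) →
      ∑ Z, f Z.card * (upSum (e s.1 s.2.1 s.pos) Z : ℂ) * (upSum (e s'.1 s'.2.1 s'.pos) Z : ℂ)
        = 0 := by
    intro h0
    rw [(h.chain s.1 s.2.1).sum_upSum (h.chain s'.1 s'.2.1)]
    simp only [h0, Int.cast_zero, mul_zero, sum_const_zero]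
  by_cases hk : s.1 = s'.1
  · obtain ⟨k, b, r⟩ := s
    obtain ⟨k', b', r'⟩ := s'
    obtain rfl : k = k' := hk
    rw [repeatBlocks_apply_same]
    by_cases hb : b = b'
    · subst hb
      rw [if_pos rfl, subsetSumBlocks, Matrix.of_apply]
      dsimp only
      split_ifs with hij
      · have hc := h.chain k b
        have hpos : (0 : ℝ) < ((e k b 0 ⬝ᵥ e k b 0 : ℤ) : ℝ) := by
          exact_mod_cast hc.dot_self_pos (Nat.zero_le _)
        rw [hc.sum_upSum_self, hc.dot_self (ChainIdx.pos ⟨k, b, r⟩),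
          hc.dot_self (ChainIdx.pos ⟨k, b, r'⟩)]
        have e1 : ChainIdx.pos ⟨k, b, r⟩ = i - k := by rw [← hij.1]; rfl
        have e2 : ChainIdx.pos ⟨k, b, r'⟩ = j - k := by rw [← hij.2]; rfl
        rw [e1, e2, blockCoef]
        push_cast
        have hden : ((Real.sqrt ((n - 2 * k : ℕ).choose (i - k) * ((e k b 0 ⬝ᵥ e k b 0 : ℤ) : ℝ)) *
            Real.sqrt ((n - 2 * k : ℕ).choose (j - k) * ((e k b 0 ⬝ᵥ e k b 0 : ℤ) : ℝ)) : ℝ) : ℂ) =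
            ((Real.sqrt ((n - 2 * k : ℕ).choose (i - k)) *
              Real.sqrt ((n - 2 * k : ℕ).choose (j - k)) : ℝ) : ℂ) *
            ((e k b 0 ⬝ᵥ e k b 0 : ℤ) : ℂ) := by
          rw [← Complex.ofReal_intCast, ← Complex.ofReal_mul,
            Real.sqrt_mul (Nat.cast_nonneg _), Real.sqrt_mul (Nat.cast_nonneg _)]
          congr 1
          linear_combination Real.sqrt ((n - 2 * k : ℕ).choose (i - k)) *
            Real.sqrt ((n - 2 * k : ℕ).choose (j - k)) * Real.mul_self_sqrt hpos.le
        push_cast at hden ⊢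
        rw [hden, mul_div_mul_right]
        exact_mod_cast hc.ne_zero
      · rw [zero_div]
    · rw [if_neg hb, hzero (h.dot_of_ne _ _ _ hb), ite_self, zero_div]
  · rw [hzero (fun a a' => h.dot_of_rank_ne _ _ hk _ _ _ _), ite_self, zero_div]
    obtain ⟨k, x⟩ := s
    obtain ⟨k', y⟩ := s'
    rw [repeatBlocks_apply_of_ne _ hk]

/-! ### The matrices M^t_{i,j} as subset sums and as a spanning set -/

/-- Binomial inversion: C(t + d, t + u) C(t + u, t) = C(t + d, t) C(d, u) reduces the sum to the
alternating sum of a row of Pascal's triangle. -/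
theorem sum_choose_mul_choose (m t : ℕ) :
    ∑ u ∈ range (m + 1), (m.choose u : ℤ) * ((-1) ^ (u + t) * u.choose t) =
      if m = t then 1 else 0 := by
  rcases lt_or_ge m t with h | h
  · rw [if_neg h.ne]
    refine sum_eq_zero fun u hu => ?_
    rw [Nat.choose_eq_zero_of_lt (n := u) (by rw [mem_range] at hu; omega)]
    simp
  · obtain ⟨d, rfl⟩ := Nat.exists_eq_add_of_le h
    rw [add_assoc, sum_range_add, sum_eq_zero, zero_add]
    · have h1 : ∀ u ∈ range (d + 1), ((t + d).choose (t + u) : ℤ) *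
          ((-1) ^ (t + u + t) * ((t + u).choose t : ℤ)) =
          ((t + d).choose t : ℤ) * ((-1) ^ u * (d.choose u : ℤ)) := by
        intro u hu
        have h2 := Nat.choose_mul (n := t + d) (k := t + u) (s := t) (by omega)
        rw [Nat.add_sub_cancel_left, Nat.add_sub_cancel_left] at h2
        zify at h2
        have h3 : (-1 : ℤ) ^ (t + u + t) = (-1) ^ u := by
          rw [show t + u + t = u + 2 * t by ring, pow_add, pow_mul]; simp
        rw [h3]
        linear_combination (-1 : ℤ) ^ u * h2
      rw [sum_congr rfl h1, ← mul_sum, Int.alternating_sum_range_choose]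
      rcases eq_or_ne d 0 with rfl | hd
      · simp
      · simp [hd]
    · intro u hu
      rw [Nat.choose_eq_zero_of_lt (n := u) (mem_range.1 hu)]
      simp

theorem matM_eq_subsetSumMatrix (n i j t : ℕ) :
    matM n i j t = subsetSumMatrix n i j fun u => (((-1) ^ (u + t) * u.choose t : ℤ) : ℂ) := by
  ext X Y
  rw [matM, subsetSumMatrix, Matrix.of_apply, Matrix.of_apply,
    sum_powerset_apply_card (fun u => (((-1) ^ (u + t) * u.choose t : ℤ) : ℂ))]
  have h := congrArg (Int.cast (R := ℂ)) (sum_choose_mul_choose (X ∩ Y).card t)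
  rw [Int.cast_sum] at h
  simp only [nsmul_eq_mul]
  push_cast at h ⊢
  rw [h]
  by_cases h1 : X.card = i ∧ Y.card = j
  · by_cases h2 : (X ∩ Y).card = t <;> simp [h1, h2]
  · rw [if_neg h1, if_neg fun h2 => h1 ⟨h2.1, h2.2.1⟩]

/-- Two subsets cut the ground set into four parts, whose sizes are determined by the three
cardinalities; bijections between corresponding parts combine to a permutation. -/
theorem exists_perm_map {n : ℕ} {X Y X' Y' : Finset (Fin n)} (hX : X.card = X'.card)
    (hY : Y.card = Y'.card) (hXY : (X ∩ Y).card = (X' ∩ Y').card) :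
    ∃ π : Equiv.Perm (Fin n), X.map π.toEmbedding = X' ∧ Y.map π.toEmbedding = Y' := by
  have hfib : ∀ c : Prop × Prop,
      Nonempty ({x // ((x ∈ X, x ∈ Y) : Prop × Prop) = c} ≃
        {x // ((x ∈ X', x ∈ Y') : Prop × Prop) = c}) := by
    classical
    rintro ⟨p, q⟩
    refine Fintype.card_eq.1 ?_
    have h1 := card_sdiff_add_card_inter X Y
    have h1' := card_sdiff_add_card_inter X' Y'
    have h2 := card_sdiff_add_card_inter Y X
    have h2' := card_sdiff_add_card_inter Y' X'
    have h3 := card_union_add_card_inter X Y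
    have h3' := card_union_add_card_inter X' Y'
    have h4 := card_compl_add_card (X ∪ Y)
    have h4' := card_compl_add_card (X' ∪ Y')
    rw [inter_comm] at h2 h2'
    simp only [Fintype.card_subtype, Prod.mk.injEq, eq_iff_iff]
    have e1 : ∀ A B : Finset (Fin n), univ.filter (fun x => x ∈ A ∧ x ∈ B) = A ∩ B := by
      intro A B; ext; simp
    have e2 : ∀ A B : Finset (Fin n), univ.filter (fun x => x ∈ A ∧ x ∉ B) = A \ B := by
      intro A B; ext; simp
    have e3 : ∀ A B : Finset (Fin n), univ.filter (fun x => x ∉ A ∧ x ∈ B) = B \ A := by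
      intro A B; ext; simp [and_comm]
    have e4 : ∀ A B : Finset (Fin n), univ.filter (fun x => x ∉ A ∧ x ∉ B) = (A ∪ B)ᶜ := by
      intro A B; ext; simp
    by_cases hp : p <;> by_cases hq : q <;> simp only [hp, hq, iff_true, iff_false, e1, e2, e3, e4]
      <;> omega
  let π : Equiv.Perm (Fin n) := Equiv.ofFiberEquiv fun c => (hfib c).some
  have hπ : ∀ x, ((π x ∈ X', π x ∈ Y') : Prop × Prop) = (x ∈ X, x ∈ Y) :=
    Equiv.ofFiberEquiv_map fun c => (hfib c).some
  simp only [Prod.mk.injEq, eq_iff_iff] at hπ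
  refine ⟨π, ?_, ?_⟩
  · ext x
    obtain ⟨y, rfl⟩ := π.surjective x
    simp [(hπ y).1]
  · ext x
    obtain ⟨y, rfl⟩ := π.surjective x
    simp [(hπ y).2]

theorem eq_sum_matM {n : ℕ} {M : Matrix (Finset (Fin n)) (Finset (Fin n)) ℂ}
    (hM : M ∈ terwilliger n) :
    ∃ c : ℕ → ℕ → ℕ → ℂ, M = ∑ i ∈ range (n + 1), ∑ j ∈ range (n + 1), ∑ t ∈ range (n + 1),
      c i j t • matM n i j t := by
  classical
  have hex : ∀ i j t : ℕ, ∃ c : ℂ, ∀ X Y : Finset (Fin n), X.card = i → Y.card = j →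
      (X ∩ Y).card = t → M X Y = c := by
    intro i j t
    by_cases h : ∃ X Y : Finset (Fin n), X.card = i ∧ Y.card = j ∧ (X ∩ Y).card = t
    · obtain ⟨X', Y', h1, h2, h3⟩ := h
      refine ⟨M X' Y', fun X Y hX hY hXY => ?_⟩
      obtain ⟨π, rfl, rfl⟩ := exists_perm_map (hX.trans h1.symm) (hY.trans h2.symm)
        (hXY.trans h3.symm)
      exact (hM π X Y).symm
    -- A triple realized by no pair has a zero matrix, so its coefficient is arbitrary.
    · exact ⟨0, fun X Y h1 h2 h3 => absurd ⟨X, Y, h1, h2, h3⟩ h⟩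
  choose c hc using hex
  refine ⟨c, ?_⟩
  ext X Y
  have hle : ∀ Z : Finset (Fin n), Z.card ∈ range (n + 1) := fun Z => by
    rw [mem_range, Nat.lt_succ_iff]
    exact card_finset_fin_le Z
  simp only [Matrix.sum_apply, Matrix.smul_apply, matM, Matrix.of_apply]
  rw [sum_eq_single_of_mem _ (hle X), sum_eq_single_of_mem _ (hle Y),
    sum_eq_single_of_mem _ (hle (X ∩ Y))]
  · simp [hc _ _ _ X Y rfl rfl rfl]
  · intro t _ ht
    simp [ht.symm]
  · intro j _ hj
    simp [hj.symm]
  · intro i _ hi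
    simp [hi.symm]

/-! ### The block entries in terms of β -/

theorem binom_natCast (a b : ℕ) : binom a b = (a.choose b : ℤ) := by
  rw [binom, if_pos (Int.natCast_nonneg b), Int.toNat_natCast, Ring.choose_natCast]

theorem binom_of_neg {a b : ℤ} (hb : b < 0) : binom a b = 0 := if_neg (not_le.2 hb)

/-- With u = k + c: outside k ≤ u ≤ min(i, j) some binomial has a negative lower entry, and inside
all entries are natural numbers. -/
theorem beta_eq_sum {n i j k : ℕ} (t : ℕ) (hk : 2 * k ≤ n) (hi : k ≤ i) (hi' : i ≤ n - k)
    (hj : k ≤ j) (hj' : j ≤ n - k) :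
    beta n i j k t = ∑ c ∈ range (min (i - k) (j - k) + 1),
      ((n - 2 * k - c).choose (i - k - c) : ℤ) * ((n - 2 * k - c).choose (j - k - c) : ℤ) *
        ((n - 2 * k).choose c : ℤ) * ((-1) ^ (k + c + t) * (k + c).choose t) := by
  have hterm : ∀ c ∈ range (min (i - k) (j - k) + 1),
      ((n - 2 * k - c).choose (i - k - c) : ℤ) * ((n - 2 * k - c).choose (j - k - c) : ℤ) *
        ((n - 2 * k).choose c : ℤ) * ((-1) ^ (k + c + t) * (k + c).choose t) =
      (-1) ^ (k + c + t) * binom ((k + c : ℕ) : ℤ) t * binom (n - 2 * k) ((k + c : ℕ) - k) *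
        binom (n - k - (k + c : ℕ)) (i - (k + c : ℕ)) *
          binom (n - k - (k + c : ℕ)) (j - (k + c : ℕ)) := by
    intro c hc
    rw [mem_range] at hc
    rw [show ((n : ℤ) - 2 * k) = ((n - 2 * k : ℕ) : ℤ) by omega,
      show (((k + c : ℕ) : ℤ) - k) = (c : ℤ) by omega,
      show ((n : ℤ) - k - ((k + c : ℕ) : ℤ)) = ((n - 2 * k - c : ℕ) : ℤ) by omega,
      show ((i : ℤ) - ((k + c : ℕ) : ℤ)) = ((i - k - c : ℕ) : ℤ) by omega,
      show ((j : ℤ) - ((k + c : ℕ) : ℤ)) = ((j - k - c : ℕ) : ℤ) by omega]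
    simp only [binom_natCast]
    ring
  rw [sum_congr rfl hterm, beta,
    show n + 1 = k + (min (i - k) (j - k) + 1) + (n - min i j) by omega, sum_range_add,
    sum_range_add, sum_eq_zero, sum_eq_zero (s := range (n - min i j)), zero_add, add_zero]
  · intro u _
    rcases le_total i j with hij | hij
    · rw [binom_of_neg (b := (i : ℤ) - _) (by push_cast; omega)]
      simp
    · rw [binom_of_neg (b := (j : ℤ) - _) (by push_cast; omega)]
      simp
  · intro u hu
    rw [mem_range] at hu
    rw [binom_of_neg (b := (u : ℤ) - _) (by omega)]
    simp

theorem Phi_eq_of_conjN {n : ℕ} {σ : ChainOrder n} {M : Matrix (Finset (Fin n)) (Finset (Fin n)) ℂ}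
    {B : BlockAlg n} (h : conjN σ M = repeatBlocks B) : Phi σ M = B := by
  rw [Phi, h, dropBlocks_repeatBlocks]

theorem rpow_neg_half (a : ℕ) : (a : ℝ) ^ (-(1 / 2) : ℝ) = (Real.sqrt a)⁻¹ := by
  rw [Real.rpow_neg (Nat.cast_nonneg _), Real.sqrt_eq_rpow]

theorem subsetSumBlocks_alternating {n i j : ℕ} (t : ℕ) (k : Fin (n / 2 + 1)) :
    subsetSumBlocks n i j (fun u => (((-1) ^ (u + t) * u.choose t : ℤ) : ℂ)) k =
      if h : i ∈ Finset.Icc (k : ℕ) (n - k) ∧ j ∈ Finset.Icc (k : ℕ) (n - k) then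
        ((((n - 2 * k : ℕ).choose (i - k) : ℝ) ^ (-(1 / 2) : ℝ) *
          ((n - 2 * k : ℕ).choose (j - k) : ℝ) ^ (-(1 / 2) : ℝ) *
          (beta n i j k t : ℝ) : ℝ) : ℂ) •
          Matrix.single (⟨i, h.1⟩ : BlockIdx n k) (⟨j, h.2⟩ : BlockIdx n k) (1 : ℂ)
      else 0 := by
  have hk := Nat.lt_succ_iff.1 k.2
  ext r s
  rw [subsetSumBlocks, Matrix.of_apply]
  split_ifs with h1 h2 h2
  · obtain ⟨rfl, rfl⟩ := h1
    have hi := mem_Icc.1 h2.1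
    have hj := mem_Icc.1 h2.2
    rw [Matrix.smul_apply, Matrix.single_apply_same, smul_eq_mul, mul_one, rpow_neg_half,
      rpow_neg_half, beta_eq_sum t (by omega) hi.1 hi.2 hj.1 hj.2, blockCoef]
    push_cast
    rw [div_eq_mul_inv, mul_inv, mul_comm]
  · exact absurd ⟨h1.1 ▸ r.2, h1.2 ▸ s.2⟩ h2
  · rw [Matrix.smul_apply, Matrix.single_apply_of_ne, smul_zero]
    rintro ⟨h3, h4⟩
    exact h1 ⟨(congrArg Subtype.val h3).symm, (congrArg Subtype.val h4).symm⟩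
  · rfl

/-! ### The image of the Terwilliger algebra -/

/-- Only the term `c = 0` survives, and it is a product of two positive binomials. -/
theorem blockCoef_single_ne_zero {n i j k : ℕ} (hi : i ∈ Finset.Icc k (n - k))
    (hj : j ∈ Finset.Icc k (n - k)) :
    blockCoef n i j (fun u => if u = k then 1 else 0) k ≠ 0 := by
  rw [mem_Icc] at hi hj
  have h1 : 0 < (n - 2 * k).choose (i - k) := Nat.choose_pos (by omega)
  have h2 : 0 < (n - 2 * k).choose (j - k) := Nat.choose_pos (by omega)
  have h1' : (0 : ℝ) < (n - 2 * k).choose (i - k) := by exact_mod_cast h1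
  have h2' : (0 : ℝ) < (n - 2 * k).choose (j - k) := by exact_mod_cast h2
  refine div_ne_zero ?_ ?_
  · rw [sum_range_succ', sum_eq_zero]
    · simp [h1.ne', h2.ne']
    · intro c _
      dsimp only
      rw [if_neg (by omega), mul_zero]
  · rw [Complex.ofReal_ne_zero]
    positivity

theorem blockCoef_single_eq_zero {n i j k u : ℕ} (h : u < k) :
    blockCoef n i j (fun v => if v = u then 1 else 0) k = 0 := by
  rw [blockCoef, sum_eq_zero, zero_div]
  intro c _
  rw [if_neg (by omega), mul_zero]

/-- The matrix units of the block algebra lie in the image of the Terwilliger algebra. -/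
theorem IsChainBasis.repeatBlocks_single_mem {n : ℕ} {σ : ChainOrder n}
    {e : (k : Fin (n / 2 + 1)) → Fin (chainCount n k) → ℕ → Finset (Fin n) → ℤ}
    (h : IsChainBasis σ e) (m : ℕ) : ∀ (k : Fin (n / 2 + 1)), (k : ℕ) = m →
      ∀ (r s : BlockIdx n k), repeatBlocks (Pi.single k (Matrix.single r s (1 : ℂ))) ∈
        (Subalgebra.toSubmodule (terwilliger n).toSubalgebra).map (conjNLin σ) := by
  induction m using Nat.strong_induction_on with
  | _ m ih =>
    rintro k rfl r s
    set P := (Subalgebra.toSubmodule (terwilliger n).toSubalgebra).map (conjNLin σ)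
    -- With this weight the blocks beyond `k` vanish, the `k`-th is a nonzero multiple of the wanted
    -- matrix unit, and the earlier ones are multiples of matrix units known by induction, which can
    -- be subtracted.
    set f : ℕ → ℂ := fun u => if u = k then 1 else 0
    have hc : blockCoef n r s f k ≠ 0 := blockCoef_single_ne_zero r.2 s.2
    have hmem : repeatBlocks (subsetSumBlocks n r s f) ∈ P :=
      ⟨_, subsetSumMatrix_mem n r s f, h.conjN_subsetSumMatrix r s f⟩
    have hzero : repeatBlocks (0 : BlockAlg n) ∈ P := by
      rw [show repeatBlocks (0 : BlockAlg n) = 0 from map_zero (repeatBlocksLin n)]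
      exact P.zero_mem
    have hlow : ∀ k', k' ≠ k → repeatBlocks (Pi.single k' (subsetSumBlocks n r s f k')) ∈ P := by
      intro k' hk'
      rcases lt_or_gt_of_ne hk' with hlt | hgt
      · by_cases hrs : (r : ℕ) ∈ Finset.Icc (k' : ℕ) (n - k') ∧
            (s : ℕ) ∈ Finset.Icc (k' : ℕ) (n - k')
        · have : subsetSumBlocks n r s f k' = blockCoef n r s f k' •
              Matrix.single (⟨r, hrs.1⟩ : BlockIdx n k') (⟨s, hrs.2⟩ : BlockIdx n k') (1 : ℂ) := by
            ext x y
            rw [subsetSumBlocks, Matrix.of_apply, Matrix.smul_apply, Matrix.single_apply]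
            simp only [Subtype.ext_iff, eq_comm (a := (r : ℕ)), eq_comm (a := (s : ℕ))]
            split_ifs <;> simp
          rw [this, Pi.single_smul, repeatBlocks_smul]
          exact P.smul_mem _ (ih k' hlt k' rfl _ _)
        · have : subsetSumBlocks n r s f k' = 0 := by
            ext x y
            rw [subsetSumBlocks, Matrix.of_apply, if_neg, Matrix.zero_apply]
            rintro ⟨h1, h2⟩
            exact hrs ⟨h1 ▸ x.2, h2 ▸ y.2⟩
          rw [this, Pi.single_zero]
          exact hzero
      · have : subsetSumBlocks n r s f k' = 0 := by
          ext x y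
          rw [subsetSumBlocks, Matrix.of_apply, blockCoef_single_eq_zero hgt, ite_self,
            Matrix.zero_apply]
        rw [this, Pi.single_zero]
        exact hzero
    have hself : subsetSumBlocks n r s f k = blockCoef n r s f k • Matrix.single r s (1 : ℂ) := by
      ext x y
      rw [subsetSumBlocks, Matrix.of_apply, Matrix.smul_apply, Matrix.single_apply]
      simp only [Subtype.ext_iff, eq_comm (a := (r : ℕ)), eq_comm (a := (s : ℕ))]
      split_ifs <;> simp
    have hsum : repeatBlocks (subsetSumBlocks n r s f) =
        ∑ k', repeatBlocks (Pi.single k' (subsetSumBlocks n r s f k')) := by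
      have := map_sum (repeatBlocksLin n)
        (fun k' => Pi.single k' (subsetSumBlocks n r s f k')) univ
      rw [Finset.univ_sum_single] at this
      exact this
    rw [hsum, ← add_sum_erase _ _ (mem_univ k), hself, Pi.single_smul, repeatBlocks_smul] at hmem
    have h1 := (P.add_mem_iff_left
      (P.sum_mem fun k' hk' => hlow k' (ne_of_mem_erase hk'))).1 hmem
    exact (P.smul_mem_iff hc).1 h1

theorem IsChainBasis.map_conjNLin {n : ℕ} {σ : ChainOrder n}
    {e : (k : Fin (n / 2 + 1)) → Fin (chainCount n k) → ℕ → Finset (Fin n) → ℤ}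
    (h : IsChainBasis σ e) :
    (Subalgebra.toSubmodule (terwilliger n).toSubalgebra).map (conjNLin σ) =
      LinearMap.range (repeatBlocksLin n) := by
  refine le_antisymm ?_ ?_
  · rw [Submodule.map_le_iff_le_comap]
    intro M hM
    obtain ⟨c, hc⟩ := eq_sum_matM (show M ∈ terwilliger n from hM)
    rw [hc]
    refine Submodule.sum_mem _ fun i _ => Submodule.sum_mem _ fun j _ =>
      Submodule.sum_mem _ fun t _ => Submodule.smul_mem _ _ ?_
    rw [matM_eq_subsetSumMatrix]
    exact ⟨_, (h.conjN_subsetSumMatrix i j _).symm⟩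
  · rintro _ ⟨B, rfl⟩
    rw [← Finset.univ_sum_single B, map_sum]
    refine Submodule.sum_mem _ fun k _ => ?_
    have hB : (Pi.single k (B k) : BlockAlg n) =
        ∑ r, ∑ s, B k r s • Pi.single k (Matrix.single r s (1 : ℂ)) := by
      have h1 := congrArg (LinearMap.single ℂ (fun k : Fin (n / 2 + 1) =>
        Matrix (BlockIdx n k) (BlockIdx n k) ℂ) k) (Matrix.matrix_eq_sum_single (B k))
      rw [map_sum] at h1
      refine h1.trans (sum_congr rfl fun r _ => ?_)
      rw [map_sum]
      refine sum_congr rfl fun s _ => ?_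
      rw [← Pi.single_smul, Matrix.smul_single, smul_eq_mul, mul_one]
      rfl
    rw [hB, map_sum]
    refine Submodule.sum_mem _ fun r _ => ?_
    rw [map_sum]
    refine Submodule.sum_mem _ fun s _ => ?_
    rw [map_smul]
    exact Submodule.smul_mem _ _ (h.repeatBlocks_single_mem k k rfl r s)

theorem IsChainBasis.image_conjN {n : ℕ} {σ : ChainOrder n}
    {e : (k : Fin (n / 2 + 1)) → Fin (chainCount n k) → ℕ → Finset (Fin n) → ℤ}
    (h : IsChainBasis σ e) :
    conjN σ '' (terwilliger n : Set (Matrix (Finset (Fin n)) (Finset (Fin n)) ℂ)) =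
      Set.range (repeatBlocks (n := n)) :=
  congrArg (fun P : Submodule ℂ _ => (P : Set (Matrix (ChainIdx n) (ChainIdx n) ℂ)))
    h.map_conjNLin

/-! ### The isomorphism of star algebras -/

theorem IsChainBasis.conjN_injective {n : ℕ} {σ : ChainOrder n}
    {e : (k : Fin (n / 2 + 1)) → Fin (chainCount n k) → ℕ → Finset (Fin n) → ℤ}
    (h : IsChainBasis σ e) : Function.Injective (conjN σ) := by
  have hinv : ∀ M, matNC σ * conjN σ M * (matNC σ).conjTranspose = M := by
    intro M
    rw [conjN, ← Matrix.mul_assoc, ← Matrix.mul_assoc, h.mul_conjTranspose_self, Matrix.one_mul,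
      Matrix.mul_assoc, h.mul_conjTranspose_self, Matrix.mul_one]
  intro M M' hM
  rw [← hinv M, hM, hinv]

theorem IsChainBasis.conjN_mul {n : ℕ} {σ : ChainOrder n}
    {e : (k : Fin (n / 2 + 1)) → Fin (chainCount n k) → ℕ → Finset (Fin n) → ℤ}
    (h : IsChainBasis σ e) (M M' : Matrix (Finset (Fin n)) (Finset (Fin n)) ℂ) :
    conjN σ (M * M') = conjN σ M * conjN σ M' := by
  simp only [conjN, Matrix.mul_assoc]
  rw [← Matrix.mul_assoc (matNC σ) (matNC σ).conjTranspose, h.mul_conjTranspose_self,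
    Matrix.one_mul]

theorem conjN_conjTranspose {n : ℕ} (σ : ChainOrder n)
    (M : Matrix (Finset (Fin n)) (Finset (Fin n)) ℂ) :
    conjN σ M.conjTranspose = (conjN σ M).conjTranspose := by
  simp only [conjN, Matrix.conjTranspose_mul, Matrix.conjTranspose_conjTranspose, Matrix.mul_assoc]

/-- `dropBlocks` need not respect products of arbitrary matrices, but on the image of the algebra it
inverts `repeatBlocks`. Each algebraic law is therefore checked after applying `repeatBlocks`, where
it is a law of conjugation by a unitary matrix. -/
theorem IsChainBasis.exists_starAlgEquiv {n : ℕ} {σ : ChainOrder n}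
    {e : (k : Fin (n / 2 + 1)) → Fin (chainCount n k) → ℕ → Finset (Fin n) → ℤ}
    (h : IsChainBasis σ e) :
    ∃ Ψ : terwilliger n ≃⋆ₐ[ℂ] BlockAlg n, ∀ M : terwilliger n, Ψ M = Phi σ M.1 := by
  have hrep : ∀ M : terwilliger n, conjN σ M.1 = repeatBlocks (Phi σ M.1) := by
    intro M
    obtain ⟨B, hB⟩ : conjN σ M.1 ∈ Set.range (repeatBlocks (n := n)) :=
      h.image_conjN ▸ Set.mem_image_of_mem _ M.2
    rw [Phi_eq_of_conjN hB.symm, hB]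
  have hbij : Function.Bijective fun M : terwilliger n => Phi σ M.1 := by
    constructor
    · intro M M' hM
      refine Subtype.ext (h.conjN_injective ?_)
      rw [hrep M, hrep M']
      exact congrArg repeatBlocks hM
    · intro B
      obtain ⟨M, hM, hMB⟩ : repeatBlocks B ∈ conjN σ '' (terwilliger n : Set _) :=
        h.image_conjN.symm ▸ Set.mem_range_self B
      exact ⟨⟨M, hM⟩, Phi_eq_of_conjN hMB⟩
  refine ⟨{ Equiv.ofBijective _ hbij with
    map_mul' := fun M M' => Phi_eq_of_conjN ?_
    map_add' := fun M M' => Phi_eq_of_conjN ?_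
    map_star' := fun M => Phi_eq_of_conjN ?_
    map_smul' := fun c M => Phi_eq_of_conjN ?_ }, fun M => rfl⟩
  · exact (h.conjN_mul _ _).trans (by rw [hrep M, hrep M', ← repeatBlocks_mul]; rfl)
  · exact ((conjNLin σ).map_add _ _).trans
      (by rw [repeatBlocks_add]; exact congrArg₂ _ (hrep M) (hrep M'))
  · exact (conjN_conjTranspose σ _).trans (by rw [hrep M, ← repeatBlocks_star]; rfl)
  · exact ((conjNLin σ).map_smul c _).trans
      (by rw [repeatBlocks_smul]; exact congrArg _ (hrep M))

theorem theorem4 (n : ℕ) :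
    -- the number of chains of `O(n)` from rank `k` to rank `n - k` is `q_k`
    (∀ k : Fin (n / 2 + 1), (chainsFrom n k).length = chainCount n k) ∧
    -- and for every ordering of these chains
    ∀ σ : ChainOrder n,
      -- the vectors of `O(n)` are indexed bijectively, and by their ranks
      (Function.Injective (basisVec σ) ∧
        Set.range (basisVec σ) = {v | ∃ c ∈ boolChains n, v ∈ c} ∧
        ∀ s : ChainIdx n, HasRank (basisVec σ s) s.2.2.1) ∧
      -- `N(n)` is unitary
      ((matNC σ).conjTranspose * matNC σ = 1 ∧ matNC σ * (matNC σ).conjTranspose = 1) ∧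
      -- conjugation by `N(n)` block diagonalizes the Terwilliger algebra
      (conjN σ '' (terwilliger n : Set (Matrix (Finset (Fin n)) (Finset (Fin n)) ℂ)) =
        Set.range (repeatBlocks (n := n))) ∧
      -- `Φ` is an isomorphism of star algebras
      (∃ Ψ : terwilliger n ≃⋆ₐ[ℂ] BlockAlg n,
        ∀ M : terwilliger n, Ψ M = Phi σ M.1) ∧
      -- the images of the matrices `M^t_{i,j}`
      ∀ i j t : ℕ, i ≤ n → j ≤ n → t ≤ n → ∀ k : Fin (n / 2 + 1),
        Phi σ (matM n i j t) k =
          if h : i ∈ Finset.Icc (k : ℕ) (n - k) ∧ j ∈ Finset.Icc (k : ℕ) (n - k) then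
            ((((n - 2 * k : ℕ).choose (i - k) : ℝ) ^ (-(1 / 2) : ℝ) *
              ((n - 2 * k : ℕ).choose (j - k) : ℝ) ^ (-(1 / 2) : ℝ) *
              (beta n i j k t : ℝ) : ℝ) : ℂ) •
              Matrix.single (⟨i, h.1⟩ : BlockIdx n k) (⟨j, h.2⟩ : BlockIdx n k) (1 : ℂ)
          else 0 := by
  refine ⟨fun k => length_chainsFrom ?_, fun σ => ?_⟩
  · have := Nat.lt_succ_iff.1 k.2
    omega
  · obtain ⟨e, h⟩ := exists_isChainBasis σ
    refine ⟨⟨h.basisVec_injective, h.range_basisVec, h.hasRank⟩,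
      ⟨h.conjTranspose_mul_self, h.mul_conjTranspose_self⟩, h.image_conjN, h.exists_starAlgEquiv,
      fun i j t _ _ _ k => ?_⟩
    rw [matM_eq_subsetSumMatrix, Phi_eq_of_conjN (h.conjN_subsetSumMatrix i j _),
      subsetSumBlocks_alternating]
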